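/- Let $M$ be a smooth real supermanifold of dimension $n|m$, with local coordinates $x^A$ of parity $\widetilde A\in\mathbb Z_2$, and let $T^*M$ be its cotangent bundle with natural coordinates $(x^A,p_A)$, where $\widetilde{p_A}=\widetilde A$ and $\overline p_A=\frac{\partial x^B}{\partial\overline x^A}p_B$ under a change of coordinates. Equip $C^\infty(T^*M)$ with the canonical Poisson bracket $$\{F,G\}=(-1)^{\widetilde A\widetilde F+\widetilde A}\frac{\partial F}{\partial p_A}\frac{\partial G}{\partial x^A}-(-1)^{\widetilde A\widetilde F}\frac{\partial F}{\partial x^A}\frac{\partial G}{\partial p_A}$$ (left derivatives, summation over $A$). The symbol of a vector field $X=X^A\frac{\partial}{\partial x^A}$ on $M$ is the function $\mathcal X=X^Ap_A\in C^\infty(T^*M)$. The Lie derivative along $X$ is $L_XF=\{\mathcal X,F\}$ on functions $F\in C^\infty(T^*M)$ and $L_XY=[X,Y]$ (the supercommutator) on vector fields $Y$. A QS structure on $M$ is a pair $(\widehat S,\widehat Q)$ of an odd function $\widehat S\in C^\infty(T^*M)$, homogeneous of degree two in the fibre coordinates $p_A$, and an odd vector field $\widehat Q$ on $M$ such that $\widehat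 Q^2=0$, $L_{\widehat Q}\widehat S=0$ and $\{\widehat S,\widehat S\}=0$. An exact QS-manifold $(M,\widehat Q,\widehat S,E)$ is a supermanifold $M$ with a QS structure $(\widehat S,\widehat Q)$ and an even vector field $E$ on $M$ such that $L_E\widehat S=-\widehat S$ and $L_E\widehat Q=-\widehat Q$. An odd Jacobi structure on $M$ is a pair $(S,Q)$ of an odd function $S\in C^\infty(T^*M)$, homogeneous of degree two in the fibre coordinates, and an odd vector field $Q$ on $M$ such that $Q^2=0$, $L_QS=\{\mathcal Q,S\}=0$ and $\{S,S\}=-2\mathcal Q S$. Theorem. Let $(M,\widehat Q,\widehat S,E)$ be an exact QS-manifold, and let $\mathcal E$ and $\widehat{\mathcal Q}$ be the symbols of $E$ and $\widehat Q$. Then the pair $S=\widehat S+\mathcal E\widehat{\mathcal Q}$, $Q=\widehat Q$ is an odd Jacobi structure on $M$. -/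

import Mathlib

open scoped ContDiff

universe u v

noncomputable section

/-! ## Superfunctions on superdomains

`α` and `β` index the even and the odd coordinates.  The superalgebra of smooth functions on a
superdomain over an open set `U ⊆ ℝ^α` is `C^∞(U) ⊗ Λ(β)`, that is, the algebra of smooth functions
on `U` with values in the Grassmann algebra on the odd coordinates. -/

/-- The real Grassmann algebra with one generator for each element of `β`. -/
abbrev Grassmann (β : Type) : Type := ExteriorAlgebra ℝ (β → ℝ)

instance Grassmann.instFinite (β : Type) [Fintype β] : Module.Finite ℝ (Grassmann β) := by
  classical
  let _ : LinearOrder β := LinearOrder.lift' (Fintype.equivFin β) (Fintype.equivFin β).injective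
  exact Module.Finite.of_basis (Pi.basisFun ℝ β).ExteriorAlgebra

/-- Functions of even variables with values in the Grassmann algebra of the odd variables.  Such a
function is used only on some open set, on which it is required to be smooth. -/
abbrev SuperFn (α β : Type) : Type := (α → ℝ) → Grassmann β

/-- The Grassmann parity of a coordinate. -/
def coordParity {α β : Type} : α ⊕ β → ZMod 2
  | .inl _ => 0
  | .inr _ => 1

namespace SuperFn

variable {α β : Type}

/-- Smoothness on `U`: all components in the (finite-dimensional) Grassmann algebra are smooth. -/
def SmoothOn [Fintype α] (F : SuperFn α β) (U : Set (α → ℝ)) : Prop :=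
  ∀ l : Module.Dual ℝ (Grassmann β), ContDiffOn ℝ ∞ (fun x => l (F x)) U

/-- `F` is homogeneous of parity `ε` on `U`. -/
def HasParityOn (F : SuperFn α β) (ε : ZMod 2) (U : Set (α → ℝ)) : Prop :=
  ∀ x ∈ U, F x ∈ CliffordAlgebra.evenOdd (0 : QuadraticForm ℝ (β → ℝ)) ε

/-- The coordinate functions: the even ones `x ↦ x a` and the odd ones, the Grassmann generators. -/
def coord [DecidableEq β] : α ⊕ β → SuperFn α β
  | .inl a => fun x => algebraMap ℝ (Grassmann β) (x a)
  | .inr j => fun _ => ExteriorAlgebra.ι ℝ (Pi.single j 1)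

/-- The partial derivative with respect to an even coordinate, computed componentwise in a basis of
the Grassmann algebra. -/
def evenPartial [DecidableEq α] [Fintype β] (a : α) (F : SuperFn α β) : SuperFn α β :=
  fun x => ∑ k, lineDeriv ℝ (fun z => (Module.finBasis ℝ (Grassmann β)).repr (F z) k) x
    (Pi.single a 1) • Module.finBasis ℝ (Grassmann β) k

/-- The left partial derivative with respect to an odd coordinate. -/
def oddPartial (j : β) (F : SuperFn α β) : SuperFn α β :=
  fun x => CliffordAlgebra.contractLeft (LinearMap.proj j : Module.Dual ℝ (β → ℝ)) (F x)

/-- The (left) partial derivative `∂F/∂x^A`. -/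
def partialDeriv [DecidableEq α] [Fintype β] : α ⊕ β → SuperFn α β → SuperFn α β
  | .inl a => evenPartial a
  | .inr j => oddPartial j

end SuperFn

/-- The body (the component in degree zero) of an element of the Grassmann algebra. -/
def Grassmann.body {β : Type} (a : Grassmann β) : ℝ := ExteriorAlgebra.algebraMapInv a

/-- The soul (the nilpotent part) of an element of the Grassmann algebra. -/
def Grassmann.soul {β : Type} (a : Grassmann β) : Grassmann β :=
  a - algebraMap ℝ (Grassmann β) a.body

open Classical in
/-- Substitution of elements `η j` for the Grassmann generators: the algebra morphism that sends the
`j`-th generator to `η j`.  It exists when all linear combinations of the `η j` square to zero, in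
particular whenever all `η j` are odd, which is the only case in which it is used. -/
def Grassmann.subst {β γ : Type} [Fintype γ] (η : γ → Grassmann β) :
    Grassmann γ →ₐ[ℝ] Grassmann β :=
  if h : ∀ v : γ → ℝ, Fintype.linearCombination ℝ η v * Fintype.linearCombination ℝ η v = 0 then
    ExteriorAlgebra.lift ℝ ⟨Fintype.linearCombination ℝ η, h⟩
  else
    (Algebra.ofId ℝ (Grassmann β)).comp ExteriorAlgebra.algebraMapInv

/-! ## Coordinate maps between superdomains -/

/-- The coordinate expression of a map from a superdomain with coordinates `α | β` to a superdomain
with coordinates `α' | β'`: each target coordinate is given as a superfunction on the source. -/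
abbrev SuperMap (α β α' β' : Type) : Type := α' ⊕ β' → SuperFn α β

namespace SuperMap

variable {α β α' β' : Type}

/-- The underlying map of ordinary domains. -/
def body (φ : SuperMap α β α' β') (x : α → ℝ) : α' → ℝ := fun a => (φ (.inl a) x).body

/-- The term of order `k` (without the factor `1 / k!`) in the Taylor expansion of `F` along the
souls of the even components of `φ`, with the odd components of `φ` substituted for the odd
coordinates. -/
def taylorTerm [Fintype α'] [DecidableEq α'] [Fintype β'] (φ : SuperMap α β α' β') :
    ℕ → SuperFn α' β' → SuperFn α β
  | 0, F => fun x => Grassmann.subst (fun j => φ (.inr j) x) (F (φ.body x))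
  | k + 1, F => fun x =>
      ∑ a : α', taylorTerm φ k (SuperFn.evenPartial a F) x * (φ (.inl a) x).soul

/-- The pullback `φ^* F`, that is, `F` with the components of `φ` substituted for its coordinates.
The Taylor expansion is finite, since even souls are nilpotent: any product of more than `|β|`
of them vanishes. -/
def pullback [Fintype α'] [DecidableEq α'] [Fintype β'] [Fintype β] (φ : SuperMap α β α' β')
    (F : SuperFn α' β') : SuperFn α β :=
  fun x => ∑ k ∈ Finset.range (Fintype.card β + 1),
    ((k.factorial : ℝ)⁻¹) • taylorTerm φ k F x

end SuperMap

/-! ## The cotangent superdomain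

Coordinates on the cotangent bundle of a superdomain: positions `x^A` (left summands) and momenta
`p_A` (right summands), where `p_A` has the parity of `x^A`. -/

namespace Cotangent

variable {α β : Type}

/-- The index of the position coordinate `x^A`. -/
def pos : α ⊕ β → (α ⊕ α) ⊕ (β ⊕ β) := Sum.map Sum.inl Sum.inl

/-- The index of the momentum coordinate `p_A`. -/
def mom : α ⊕ β → (α ⊕ α) ⊕ (β ⊕ β) := Sum.map Sum.inr Sum.inr

/-- The part of the cotangent superdomain that lies over `U`. -/
def overDom (U : Set (α → ℝ)) : Set (α ⊕ α → ℝ) := {z | (fun a => z (Sum.inl a)) ∈ U}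

/-- A superfunction on the base, regarded as a function on the cotangent superdomain that does not
depend on the momenta. -/
def lift (F : SuperFn α β) : SuperFn (α ⊕ α) (β ⊕ β) := fun z =>
  ExteriorAlgebra.map
    ((LinearEquiv.sumArrowLequivProdArrow β β ℝ ℝ).symm.toLinearMap ∘ₗ LinearMap.inl ℝ _ _)
    (F (fun a => z (Sum.inl a)))

/-- The momentum coordinate `p_A` as a function. -/
def p [DecidableEq β] (A : α ⊕ β) : SuperFn (α ⊕ α) (β ⊕ β) := SuperFn.coord (mom A)

/-- `F ↦ (-1)^{Ã F̃} F`, extended linearly to inhomogeneous `F`. -/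
def twist {α β γ δ : Type} : α ⊕ β → SuperFn γ δ → SuperFn γ δ
  | .inl _, F => F
  | .inr _, F => fun z => CliffordAlgebra.involute (F z)

/-- The canonical Poisson bracket
`{F, G} = ∑_A (-1)^{Ã F̃ + Ã} ∂F/∂p_A ∂G/∂x^A - (-1)^{Ã F̃} ∂F/∂x^A ∂G/∂p_A`. -/
def bracket [Fintype α] [DecidableEq α] [Fintype β] (F G : SuperFn (α ⊕ α) (β ⊕ β)) :
    SuperFn (α ⊕ α) (β ⊕ β) :=
  ∑ A : α ⊕ β,
    (((-1 : ℝ) ^ (coordParity A).val) •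
        (SuperFn.partialDeriv (mom A) (twist A F) * SuperFn.partialDeriv (pos A) G)
      - SuperFn.partialDeriv (pos A) (twist A F) * SuperFn.partialDeriv (mom A) G)

/-- The map of cotangent superdomains induced by a change of coordinates `φ` with inverse `ψ`:
the positions transform by `φ`, and `p̄_A = (∂x^B/∂x̄^A) p_B`. -/
def liftMap [Fintype α] [DecidableEq α] [Fintype β] [DecidableEq β]
    (φ ψ : SuperMap α β α β) : SuperMap (α ⊕ α) (β ⊕ β) (α ⊕ α) (β ⊕ β)
  | .inl (.inl a) => lift (φ (.inl a))
  | .inr (.inl j) => lift (φ (.inr j))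
  | .inl (.inr a) =>
      ∑ B, lift (φ.pullback (SuperFn.partialDeriv (.inl a) (ψ B))) * p B
  | .inr (.inr j) =>
      ∑ B, lift (φ.pullback (SuperFn.partialDeriv (.inr j) (ψ B))) * p B

end Cotangent

/-! ## Supermanifolds -/

/-- A smooth real supermanifold of dimension `n | m`: a Hausdorff second countable space `Body` with
charts in `ℝⁿ`, and superdomains over the chart images glued by smooth changes of coordinates (even
coordinates are even superfunctions, odd coordinates are odd superfunctions) that lie over the
changes of charts of the body and satisfy the cocycle condition. -/
structure Supermanifold (n m : ℕ) where
  /-- The underlying topological space. -/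
  Body : Type u
  [topology : TopologicalSpace Body]
  [t2 : T2Space Body]
  [secondCountable : SecondCountableTopology Body]
  /-- The index set of the atlas. -/
  Index : Type v
  /-- The charts of the body. -/
  chart : Index → OpenPartialHomeomorph Body (Fin n → ℝ)
  cover : ∀ b : Body, ∃ i, b ∈ (chart i).source
  /-- `trans i j`: the coordinates of chart `j` as superfunctions of the coordinates of chart `i`. -/
  trans : Index → Index → SuperMap (Fin n) (Fin m) (Fin n) (Fin m)
  trans_smooth : ∀ i j A, (trans i j A).SmoothOn ((chart i).symm.trans (chart j)).source
  trans_parity : ∀ i j A,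
    (trans i j A).HasParityOn (coordParity A) ((chart i).symm.trans (chart j)).source
  trans_body : ∀ i j, ∀ x ∈ ((chart i).symm.trans (chart j)).source,
    (trans i j).body x = chart j ((chart i).symm x)
  trans_self : ∀ i A, Set.EqOn (trans i i A) (SuperFn.coord A) (chart i).target
  trans_cocycle : ∀ i j k A,
    Set.EqOn ((trans i j).pullback (trans j k A)) (trans i k A)
      (((chart i).symm.trans (chart j)).source ∩ ((chart i).symm.trans (chart k)).source)

attribute [instance] Supermanifold.topology Supermanifold.t2 Supermanifold.secondCountable

namespace Supermanifold

variable {n m : ℕ} (M : Supermanifold.{u, v} n m)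

/-- The image of chart `i` in `ℝⁿ`. -/
def dom (i : M.Index) : Set (Fin n → ℝ) := (M.chart i).target

/-- The overlap of charts `i` and `j`, as an open subset of the image of chart `i`. -/
def overlap (i j : M.Index) : Set (Fin n → ℝ) :=
  ((M.chart i).symm.trans (M.chart j)).source

/-- A vector field `X = X^A ∂/∂x^A`, given by its components in all charts, which are related by the
transformation law `X̄^A = X^B ∂x̄^A/∂x^B`. -/
structure VectorField where
  /-- The component `X^A` in chart `i`. -/
  comp : (i : M.Index) → Fin n ⊕ Fin m → SuperFn (Fin n) (Fin m)
  smooth : ∀ i A, (comp i A).SmoothOn (M.dom i)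
  compat : ∀ i j A,
    Set.EqOn ((M.trans i j).pullback (comp j A))
      (∑ B, comp i B * SuperFn.partialDeriv B (M.trans i j A)) (M.overlap i j)

namespace VectorField

variable {M}

/-- `X` is homogeneous of parity `ε`: the component `X^A` has parity `ε + Ã`. -/
def HasParity (X : M.VectorField) (ε : ZMod 2) : Prop :=
  ∀ i A, (X.comp i A).HasParityOn (ε + coordParity A) (M.dom i)

/-- The derivation `f ↦ X f = X^A ∂f/∂x^A` of the superfunctions on chart `i`. -/
def act (X : M.VectorField) (i : M.Index) (f : SuperFn (Fin n) (Fin m)) :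
    SuperFn (Fin n) (Fin m) :=
  ∑ A, X.comp i A * SuperFn.partialDeriv A f

/-- The homological condition `X² = 0` of an odd vector field. -/
def IsHomological (X : M.VectorField) : Prop :=
  ∀ i, ∀ f : SuperFn (Fin n) (Fin m), f.SmoothOn (M.dom i) →
    Set.EqOn (X.act i (X.act i f)) 0 (M.dom i)

/-- `L_E X = -X` for an even vector field `E`, where `L_E X = [E, X] = E X - X E`. -/
def IsHomothetyOf (E X : M.VectorField) : Prop :=
  ∀ i, ∀ f : SuperFn (Fin n) (Fin m), f.SmoothOn (M.dom i) →
    Set.EqOn (E.act i (X.act i f) - X.act i (E.act i f)) (-X.act i f) (M.dom i)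

end VectorField

/-- The coordinate expressions, one for each chart, of a would-be function on the cotangent bundle
(see `IsCotangentFn`). -/
abbrev CotangentFamily : Type v :=
  M.Index → SuperFn (Fin n ⊕ Fin n) (Fin m ⊕ Fin m)

/-- Equality of functions on the cotangent bundle: equality in each chart. -/
def CotangentEq (F G : M.CotangentFamily) : Prop :=
  ∀ i, Set.EqOn (F i) (G i) (Cotangent.overDom (M.dom i))

/-- `F ∈ C^∞(T^*M)`: the coordinate expressions are smooth, and are transformed into each other by
the changes of coordinates that the changes of charts induce on the cotangent bundle. -/
structure IsCotangentFn (F : M.CotangentFamily) : Prop where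
  smooth : ∀ i, (F i).SmoothOn (Cotangent.overDom (M.dom i))
  compat : ∀ i j,
    Set.EqOn ((Cotangent.liftMap (M.trans i j) (M.trans j i)).pullback (F j)) (F i)
      (Cotangent.overDom (M.overlap i j))

/-- `F` is homogeneous of parity `ε`. -/
def CotangentHasParity (F : M.CotangentFamily) (ε : ZMod 2) : Prop :=
  ∀ i, (F i).HasParityOn ε (Cotangent.overDom (M.dom i))

/-- `F` is of degree two in the fibre coordinates: locally `F = F^{AB}(x) p_A p_B`. -/
def IsFibreQuadratic (F : M.CotangentFamily) : Prop :=
  ∀ i, ∃ c : Fin n ⊕ Fin m → Fin n ⊕ Fin m → SuperFn (Fin n) (Fin m),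
    (∀ A B, (c A B).SmoothOn (M.dom i)) ∧
    Set.EqOn (F i) (∑ A, ∑ B, Cotangent.lift (c A B) * Cotangent.p A * Cotangent.p B)
      (Cotangent.overDom (M.dom i))

variable {M}

/-- The canonical Poisson bracket on `C^∞(T^*M)`. -/
def bracket (F G : M.CotangentFamily) : M.CotangentFamily :=
  fun i => Cotangent.bracket (F i) (G i)

/-- The symbol `X^A p_A` of the vector field `X = X^A ∂/∂x^A`. -/
def VectorField.symbol (X : M.VectorField) : M.CotangentFamily :=
  fun i => ∑ A, Cotangent.lift (X.comp i A) * Cotangent.p A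

/-- The Lie derivative `L_X F = {symbol X, F}` of a function `F` on the cotangent bundle. -/
def VectorField.lieDeriv (X : M.VectorField) (F : M.CotangentFamily) : M.CotangentFamily :=
  bracket X.symbol F

variable (M)

/-- QS structures `(S, Q)` on `M`. -/
structure IsQS (S : M.CotangentFamily) (Q : M.VectorField) : Prop where
  isFn : M.IsCotangentFn S
  odd : M.CotangentHasParity S 1
  quadratic : M.IsFibreQuadratic S
  odd_Q : Q.HasParity 1
  homological : Q.IsHomological
  invariance : M.CotangentEq (Q.lieDeriv S) 0
  schouten : M.CotangentEq (bracket S S) 0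

/-- Exact QS structures: QS structures with a homothety vector field `E`. -/
structure IsExactQS (Q : M.VectorField) (S : M.CotangentFamily) (E : M.VectorField) : Prop where
  isQS : M.IsQS S Q
  even_E : E.HasParity 0
  homothety_S : M.CotangentEq (E.lieDeriv S) (-S)
  homothety_Q : E.IsHomothetyOf Q

/-- Odd Jacobi structures `(S, Q)` on `M`. -/
structure IsOddJacobi (S : M.CotangentFamily) (Q : M.VectorField) : Prop where
  isFn : M.IsCotangentFn S
  odd : M.CotangentHasParity S 1
  quadratic : M.IsFibreQuadratic S
  odd_Q : Q.HasParity 1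
  homological : Q.IsHomological
  invariance : M.CotangentEq (Q.lieDeriv S) 0
  compatibility : M.CotangentEq (bracket S S) ((-2 : ℝ) • (Q.symbol * S))

end Supermanifold

end

set_option linter.unusedSectionVars false

noncomputable section

open Topology Filter

/-! Write E and Q also for the symbols of the two fields, and S for the given odd quadratic
function. Inside a chart the theorem is graded Poisson algebra. The bracket of symbols is the symbol
of the supercommutator (`VectorField.bracket_symbol`), so the conditions on the fields become {E,Q}
= -Q and {Q,Q} = 0. The Leibniz rule (`IsHomogeneousAt.bracket_mul`) and graded antisymmetry
(`IsHomogeneousAt.bracket_swap`) then give {S,EQ} = SQ, {Q,EQ} = QQ = 0 and {EQ,EQ} = 0, since the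
odd element Q squares to zero. Hence {Q,S+EQ} = 0 and {S+EQ,S+EQ} = 2SQ = -2QS = -2Q(S+EQ), the last
step because QEQ = EQQ = 0. The Jacobi identity plays no role.

Most of the work is to show that S+EQ is a function on the cotangent bundle. Products are compatible
with coordinate changes because pullback is multiplicative (`SuperMap.pullback_mul`). A symbol is
invariant because the Jacobians of inverse coordinate changes are inverse matrices
(`Supermanifold.jacobian`); this is the chain rule (`SuperMap.IsRegularAt.partialDeriv_pullback`)
applied to the cocycle condition. Pullback is a truncated Taylor expansion in souls, and the degree
filtration of the Grassmann algebra makes the truncation exact. -/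

lemma ZMod.two_cases (ε : ZMod 2) : ε = 0 ∨ ε = 1 := by
  decide +revert

/-! ### Grassmann algebra: parity, contraction, degree filtration, substitution. -/

namespace Grassmann

variable {β γ : Type}

/-- The `ε`-th power of the grade involution. -/
def parityAut (ε : ZMod 2) : Grassmann β →ₐ[ℝ] Grassmann β :=
  if ε = 0 then AlgHom.id ℝ _ else CliffordAlgebra.involute

@[simp] lemma parityAut_zero (a : Grassmann β) : parityAut 0 a = a := by
  simp [parityAut]

@[simp] lemma parityAut_one (a : Grassmann β) :
    parityAut 1 a = CliffordAlgebra.involute a := by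
  simp [parityAut]

/-- The submodule of elements of parity `ε`. -/
abbrev ofParity (β : Type) (ε : ZMod 2) : Submodule ℝ (Grassmann β) :=
  CliffordAlgebra.evenOdd (0 : QuadraticForm ℝ (β → ℝ)) ε

lemma exists_even_add_odd (a : Grassmann β) :
    ∃ b ∈ ofParity β 0, ∃ c ∈ ofParity β 1, b + c = a := by
  have h : a ∈ ofParity β 0 ⊔ ofParity β 1 := by
    rw [(CliffordAlgebra.evenOdd_isCompl _).sup_eq_top]; trivial
  exact Submodule.mem_sup.1 h

/-- The odd part of a fixed element equals its own negative. With `mem_odd_iff`, this lets parity be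
checked by commuting a map with the grade involution. -/
lemma mem_even_iff {a : Grassmann β} :
    a ∈ ofParity β 0 ↔ CliffordAlgebra.involute a = a := by
  refine ⟨CliffordAlgebra.involute_eq_of_mem_even, fun h => ?_⟩
  obtain ⟨b, hb, c, hc, rfl⟩ := exists_even_add_odd a
  rw [map_add, CliffordAlgebra.involute_eq_of_mem_even hb,
    CliffordAlgebra.involute_eq_of_mem_odd hc] at h
  have : c = 0 := by
    have h2 : (2 : ℝ) • c = 0 := by
      have h3 := add_left_cancel h
      rw [two_smul]
      nth_rewrite 1 [← h3]
      simp
    simpa using h2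
  simpa [this] using hb

lemma mem_odd_iff {a : Grassmann β} :
    a ∈ ofParity β 1 ↔ CliffordAlgebra.involute a = -a := by
  refine ⟨CliffordAlgebra.involute_eq_of_mem_odd, fun h => ?_⟩
  obtain ⟨b, hb, c, hc, rfl⟩ := exists_even_add_odd a
  rw [map_add, CliffordAlgebra.involute_eq_of_mem_even hb,
    CliffordAlgebra.involute_eq_of_mem_odd hc, neg_add] at h
  have : b = 0 := by
    have h2 : (2 : ℝ) • b = 0 := by
      have h3 := add_right_cancel h
      rw [two_smul]
      nth_rewrite 1 [h3]
      simp
    simpa using h2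
  simpa [this] using hc

lemma mul_mem {ε δ : ZMod 2} {a b : Grassmann β} (ha : a ∈ ofParity β ε) (hb : b ∈ ofParity β δ) :
    a * b ∈ ofParity β (ε + δ) :=
  CliffordAlgebra.evenOdd_mul_le _ ε δ (Submodule.mul_mem_mul ha hb)

lemma algebraMap_mem (r : ℝ) : algebraMap ℝ (Grassmann β) r ∈ ofParity β 0 := by
  rw [mem_even_iff]; simp

lemma ι_mem (v : β → ℝ) : ExteriorAlgebra.ι ℝ v ∈ ofParity β 1 :=
  CliffordAlgebra.ι_mem_evenOdd_one _ v

lemma ι_mul_comm (v : β → ℝ) (a : Grassmann β) :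
    a * ExteriorAlgebra.ι ℝ v = ExteriorAlgebra.ι ℝ v * CliffordAlgebra.involute a := by
  induction a using ExteriorAlgebra.induction with
  | algebraMap r => simp [Algebra.commutes]
  | ι w =>
    rw [CliffordAlgebra.involute_ι, mul_neg]
    exact eq_neg_of_add_eq_zero_left (ExteriorAlgebra.ι_add_mul_swap w v)
  | mul a b ha hb => rw [mul_assoc, hb, ← mul_assoc, ha, mul_assoc, map_mul]
  | add a b ha hb => simp [add_mul, mul_add, ha, hb]

lemma even_mul_comm {a : Grassmann β} (ha : a ∈ ofParity β 0) (b : Grassmann β) :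
    b * a = a * b := by
  induction b using ExteriorAlgebra.induction with
  | algebraMap r => simp [Algebra.commutes]
  | ι w => rw [ι_mul_comm, CliffordAlgebra.involute_eq_of_mem_even ha]
  | mul b c hb hc => rw [mul_assoc, hc, ← mul_assoc, hb, mul_assoc]
  | add b c hb hc => simp [add_mul, mul_add, hb, hc]

lemma odd_mul_comm {a : Grassmann β} (ha : a ∈ ofParity β 1) (b : Grassmann β) :
    b * a = a * CliffordAlgebra.involute b := by
  induction b using ExteriorAlgebra.induction with
  | algebraMap r => simp [Algebra.commutes]
  | ι w => rw [CliffordAlgebra.involute_ι, mul_neg, ι_mul_comm,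
      CliffordAlgebra.involute_eq_of_mem_odd ha, mul_neg, neg_neg]
  | mul b c hb hc => rw [mul_assoc, hc, ← mul_assoc, hb, mul_assoc, map_mul]
  | add b c hb hc => simp [add_mul, mul_add, hb, hc]

lemma mul_comm_of_mem {ε : ZMod 2} {a : Grassmann β} (ha : a ∈ ofParity β ε) (b : Grassmann β) :
    b * a = a * parityAut ε b := by
  obtain rfl | rfl := ZMod.two_cases ε
  · simpa using even_mul_comm ha b
  · simpa using odd_mul_comm ha b

lemma odd_mul_self {a : Grassmann β} (ha : a ∈ ofParity β 1) : a * a = 0 := by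
  have h := odd_mul_comm ha a
  rw [CliffordAlgebra.involute_eq_of_mem_odd ha, mul_neg] at h
  have h2 : (2 : ℝ) • (a * a) = 0 := by
    rw [two_smul]; nth_rewrite 1 [h]; simp
  simpa using h2

/-! ### Contraction -/

lemma contractLeft_mul (d : Module.Dual ℝ (β → ℝ)) (a b : Grassmann β) :
    CliffordAlgebra.contractLeft d (a * b) =
      CliffordAlgebra.contractLeft d a * b +
        CliffordAlgebra.involute a * CliffordAlgebra.contractLeft d b := by
  induction a using ExteriorAlgebra.induction generalizing b with
  | algebraMap r => simp [CliffordAlgebra.contractLeft_algebraMap_mul,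
      CliffordAlgebra.contractLeft_algebraMap]
  | ι w =>
    rw [CliffordAlgebra.contractLeft_ι_mul, CliffordAlgebra.contractLeft_ι,
      CliffordAlgebra.involute_ι, Algebra.smul_def, neg_mul, sub_eq_add_neg]
  | mul a c ha hc => rw [mul_assoc, ha, hc, ha, map_mul]; noncomm_ring
  | add a c ha hc => simp only [add_mul, map_add, ha, hc]; abel

/-- Contraction lowers degree by one, so it anticommutes with the grade involution; hence odd
derivatives reverse parity. -/
lemma contractLeft_involute (d : Module.Dual ℝ (β → ℝ)) (a : Grassmann β) :
    CliffordAlgebra.contractLeft d (CliffordAlgebra.involute a) =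
      -CliffordAlgebra.involute (CliffordAlgebra.contractLeft d a) := by
  induction a using ExteriorAlgebra.induction with
  | algebraMap r => simp [CliffordAlgebra.contractLeft_algebraMap]
  | ι w => simp [CliffordAlgebra.contractLeft_ι]
  | mul a c ha hc => simp only [map_mul, contractLeft_mul, ha, hc, map_add]; noncomm_ring
  | add a c ha hc => simp only [map_add, ha, hc]; abel

lemma contractLeft_mem {d : Module.Dual ℝ (β → ℝ)} {ε : ZMod 2} {a : Grassmann β}
    (ha : a ∈ ofParity β ε) : CliffordAlgebra.contractLeft d a ∈ ofParity β (ε + 1) := by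
  fin_cases ε
  · change _ ∈ ofParity β 1
    rw [mem_odd_iff, ← neg_eq_iff_eq_neg, ← contractLeft_involute, mem_even_iff.1 ha]
  · change _ ∈ ofParity β 0
    rw [mem_even_iff, ← neg_inj, ← contractLeft_involute, mem_odd_iff.1 ha, map_neg]

/-! ### Body, soul and the filtration by degree -/

lemma body_algebraMap (r : ℝ) : (algebraMap ℝ (Grassmann β) r).body = r :=
  ExteriorAlgebra.algebraMap_leftInverse _ r

lemma soul_algebraMap (r : ℝ) : (algebraMap ℝ (Grassmann β) r).soul = 0 := by
  rw [soul, body_algebraMap, sub_self]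

lemma soul_even {a : Grassmann β} (ha : a ∈ ofParity β 0) : a.soul ∈ ofParity β 0 :=
  sub_mem ha (algebraMap_mem _)

/-- The elements all of whose components have degree at least `k`. -/
def degreeGE (β : Type) (k : ℕ) : Submodule ℝ (Grassmann β) :=
  ⨆ i : {i : ℕ // k ≤ i}, LinearMap.range (ExteriorAlgebra.ι ℝ (M := β → ℝ)) ^ (i : ℕ)

lemma degreeGE_zero : degreeGE β 0 = ⊤ := by
  rw [eq_top_iff, ← CliffordAlgebra.iSup_ι_range_eq_top]
  exact iSup_le fun i => le_iSup_of_le ⟨i, Nat.zero_le i⟩ le_rfl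

lemma mul_mem_degreeGE {k l : ℕ} {a b : Grassmann β} (ha : a ∈ degreeGE β k)
    (hb : b ∈ degreeGE β l) : a * b ∈ degreeGE β (k + l) := by
  have h : degreeGE β k * degreeGE β l ≤ degreeGE β (k + l) := by
    simp only [degreeGE, Submodule.iSup_mul, Submodule.mul_iSup, ← pow_add]
    exact iSup_le fun i => iSup_le fun j =>
      le_iSup_of_le ⟨j + i, Nat.add_le_add j.2 i.2⟩ le_rfl
  exact h (Submodule.mul_mem_mul ha hb)

/-- Exterior powers beyond the number of generators have dimension zero. This is what makes Taylor
expansions in souls finite. -/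
lemma degreeGE_eq_bot [Fintype β] {k : ℕ} (hk : Fintype.card β < k) : degreeGE β k = ⊥ := by
  rw [eq_bot_iff]
  refine iSup_le fun i => ?_
  have h := exteriorPower.finrank_eq (R := ℝ) (M := β → ℝ) (n := i.1)
  rw [Module.finrank_fintype_fun_eq_card, Nat.choose_eq_zero_of_lt (hk.trans_le i.2)] at h
  have : Module.Finite ℝ (⋀[ℝ]^(i : ℕ) (β → ℝ)) := inferInstance
  exact (Submodule.finrank_eq_zero.1 h).le

/-- Taking the body is an algebra morphism, so the soul of ab is soul(a) b + body(a) soul(b), and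
induction reduces the claim to generators. -/
lemma soul_mem_degreeGE (a : Grassmann β) : a.soul ∈ degreeGE β 1 := by
  induction a using ExteriorAlgebra.induction with
  | algebraMap r => rw [soul_algebraMap]; exact zero_mem _
  | ι w =>
    have : soul (ExteriorAlgebra.ι ℝ w : Grassmann β) = ExteriorAlgebra.ι ℝ w := by
      simp [soul, body, ExteriorAlgebra.algebraMapInv]
    rw [this]
    exact Submodule.mem_iSup_of_mem ⟨1, le_rfl⟩ (by rw [pow_one]; exact ⟨w, rfl⟩)
  | mul a b ha hb =>
    have : soul (a * b) = soul a * b + algebraMap ℝ _ (body a) * soul b := by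
      simp only [soul, body, map_mul, mul_sub, sub_mul]; abel
    rw [this]
    refine add_mem (mul_mem_degreeGE (l := 0) ha (by simp [degreeGE_zero])) ?_
    rw [← Algebra.smul_def]
    exact Submodule.smul_mem _ _ hb
  | add a b ha hb =>
    have : soul (a + b) = soul a + soul b := by
      simp only [soul, body, map_add]; abel
    rw [this]; exact add_mem ha hb

/-! ### Substitution -/

section subst

variable [Fintype γ] {η : γ → Grassmann β}

lemma linearCombination_mem (hη : ∀ j, η j ∈ ofParity β 1) (w : γ → ℝ) :
    Fintype.linearCombination ℝ η w ∈ ofParity β 1 := by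
  rw [Fintype.linearCombination_apply]
  exact Submodule.sum_mem _ fun j _ => Submodule.smul_mem _ _ (hη j)

lemma subst_ι (hη : ∀ j, η j ∈ ofParity β 1) (w : γ → ℝ) :
    subst η (ExteriorAlgebra.ι ℝ w) = ∑ j, w j • η j := by
  rw [subst, dif_pos fun v => odd_mul_self (linearCombination_mem hη v)]
  simp [Fintype.linearCombination_apply]

/-- Both sides are multiplicative in `a`, and they agree on generators since each `η j` is odd. -/
lemma subst_involute (hη : ∀ j, η j ∈ ofParity β 1) (a : Grassmann γ) :
    subst η (CliffordAlgebra.involute a) = CliffordAlgebra.involute (subst η a) := by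
  induction a using ExteriorAlgebra.induction with
  | algebraMap r => simp
  | ι w =>
    rw [CliffordAlgebra.involute_ι, map_neg, subst_ι hη, map_sum, ← Finset.sum_neg_distrib]
    refine Finset.sum_congr rfl fun j _ => ?_
    rw [map_smul, mem_odd_iff.1 (hη j), smul_neg]
  | mul a c ha hc => simp only [map_mul, ha, hc]
  | add a c ha hc => simp only [map_add, ha, hc]

lemma subst_mem (hη : ∀ j, η j ∈ ofParity β 1) {ε : ZMod 2} {a : Grassmann γ}
    (ha : a ∈ ofParity γ ε) : subst η a ∈ ofParity β ε := by
  fin_cases ε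
  · change _ ∈ ofParity β 0
    rw [mem_even_iff, ← subst_involute hη, mem_even_iff.1 ha]
  · change _ ∈ ofParity β 1
    rw [mem_odd_iff, ← subst_involute hη, mem_odd_iff.1 ha, map_neg]

end subst

/-! ### The norm -/

section norm

variable [Fintype β]

attribute [local instance] Matrix.linftyOpNormedRing Matrix.linftyOpNormedAlgebra

/-- The operator norm of left multiplication. -/
instance instNormedRing : NormedRing (Grassmann β) :=
  NormedRing.induced _ _ (Algebra.leftMulMatrix (Module.finBasis ℝ (Grassmann β)))
    (Algebra.leftMulMatrix_injective _)

/-- The existing algebra structure is kept and only the norm estimate is transported, so that no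
second scalar action appears. -/
instance instNormedAlgebra : NormedAlgebra ℝ (Grassmann β) :=
  { (inferInstance : Algebra ℝ (Grassmann β)) with
    norm_smul_le := (NormedAlgebra.induced ℝ (Grassmann β) _
      (Algebra.leftMulMatrix (Module.finBasis ℝ (Grassmann β)))).norm_smul_le }

end norm

end Grassmann

/-! ### Differential calculus of superfunctions. -/

namespace SuperFn

variable {α β γ : Type} [Fintype α] [Fintype β] [Fintype γ]

/-- In finite dimension smoothness is smoothness of the coordinates in a basis. The norm on the
Grassmann algebra is thus only an auxiliary device giving access to Fréchet derivatives. -/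
lemma smoothOn_iff {F : SuperFn α β} {U : Set (α → ℝ)} :
    F.SmoothOn U ↔ ContDiffOn ℝ ∞ F U := by
  constructor
  · intro h
    have hF : F = fun x => ∑ k, (Module.finBasis ℝ (Grassmann β)).coord k (F x) •
        Module.finBasis ℝ (Grassmann β) k := by
      funext x
      simp only [Module.Basis.coord_apply]
      exact ((Module.finBasis ℝ (Grassmann β)).sum_repr (F x)).symm
    rw [hF]
    exact ContDiffOn.sum fun k _ => (h _).smul contDiffOn_const
  · intro h l
    exact (LinearMap.toContinuousLinearMap l).contDiff.comp_contDiffOn h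

lemma SmoothOn.contDiffAt {F : SuperFn α β} {U : Set (α → ℝ)} (h : F.SmoothOn U)
    (hU : IsOpen U) {x : α → ℝ} (hx : x ∈ U) : ContDiffAt ℝ ∞ F x :=
  (smoothOn_iff.1 h).contDiffAt (hU.mem_nhds hx)

lemma _root_.ContDiffAt.eventually_differentiableAt {F : SuperFn α β} {x : α → ℝ}
    (h : ContDiffAt ℝ ∞ F x) : ∀ᶠ y in 𝓝 x, DifferentiableAt ℝ F y :=
  ((h.of_le (m := 1) (by simp)).eventually (by simp)).mono fun _ hy =>
    hy.differentiableAt (by simp)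

lemma _root_.ContDiffAt.differentiableAt_top {F : SuperFn α β} {x : α → ℝ}
    (h : ContDiffAt ℝ ∞ F x) : DifferentiableAt ℝ F x :=
  h.differentiableAt (by simp)

/-- A linear map of Grassmann algebras, as a continuous linear map. -/
abbrev clm (L : Grassmann β →ₗ[ℝ] Grassmann γ) : Grassmann β →L[ℝ] Grassmann γ :=
  LinearMap.toContinuousLinearMap L

lemma contDiffAt_linear_comp (L : Grassmann β →ₗ[ℝ] Grassmann γ) {F : SuperFn α β} {x : α → ℝ}
    (hF : ContDiffAt ℝ ∞ F x) : ContDiffAt ℝ ∞ (fun y => L (F y)) x :=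
  (clm L).contDiff.contDiffAt.comp x hF

lemma differentiableAt_linear_comp (L : Grassmann β →ₗ[ℝ] Grassmann γ) {F : SuperFn α β}
    {x : α → ℝ} (hF : DifferentiableAt ℝ F x) : DifferentiableAt ℝ (fun y => L (F y)) x :=
  (clm L).differentiableAt.comp x hF

lemma contDiffAt_mul {F G : SuperFn α β} {x : α → ℝ} (hF : ContDiffAt ℝ ∞ F x)
    (hG : ContDiffAt ℝ ∞ G x) : ContDiffAt ℝ ∞ (F * G) x :=
  ContDiffAt.mul hF hG

lemma contDiffAt_sum {ι : Type*} (s : Finset ι) {F : ι → SuperFn α β} {x : α → ℝ}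
    (hF : ∀ i ∈ s, ContDiffAt ℝ ∞ (F i) x) : ContDiffAt ℝ ∞ (∑ i ∈ s, F i) x := by
  have h := ContDiffAt.sum hF
  simpa only [← Finset.sum_apply] using h

variable [DecidableEq α]

lemma evenPartial_apply {F : SuperFn α β} {x : α → ℝ} (hF : DifferentiableAt ℝ F x) (a : α) :
    evenPartial a F x = fderiv ℝ F x (Pi.single a 1) := by
  rw [evenPartial]
  conv_rhs => rw [← (Module.finBasis ℝ (Grassmann β)).sum_repr (fderiv ℝ F x (Pi.single a 1))]
  refine Finset.sum_congr rfl fun k _ => ?_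
  congr 1
  let l : Grassmann β →L[ℝ] ℝ :=
    LinearMap.toContinuousLinearMap ((Module.finBasis ℝ (Grassmann β)).coord k)
  have h : HasFDerivAt (fun z => l (F z)) (l.comp (fderiv ℝ F x)) x :=
    l.hasFDerivAt.comp x hF.hasFDerivAt
  exact (h.hasLineDerivAt _).lineDeriv

lemma evenPartial_eventuallyEq {F : SuperFn α β} {x : α → ℝ} (hF : ContDiffAt ℝ ∞ F x) (a : α) :
    evenPartial a F =ᶠ[𝓝 x] fun y => fderiv ℝ F y (Pi.single a 1) :=
  hF.eventually_differentiableAt.mono fun _ hy => evenPartial_apply hy a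

lemma evenPartial_congr {F G : SuperFn α β} {x : α → ℝ} (h : F =ᶠ[𝓝 x] G) (a : α) :
    evenPartial a F x = evenPartial a G x := by
  refine Finset.sum_congr rfl fun k _ => ?_
  congr 1
  refine Filter.EventuallyEq.lineDeriv_eq ?_
  filter_upwards [h] with y hy
  rw [hy]

lemma partialDeriv_congr {F G : SuperFn α β} {x : α → ℝ} (h : F =ᶠ[𝓝 x] G) (A : α ⊕ β) :
    partialDeriv A F x = partialDeriv A G x := by
  cases A with
  | inl a => exact evenPartial_congr h a
  | inr j => simp only [partialDeriv, oddPartial, h.eq_of_nhds]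

lemma partialDeriv_eventuallyEq {F G : SuperFn α β} {x : α → ℝ} (h : F =ᶠ[𝓝 x] G) (A : α ⊕ β) :
    partialDeriv A F =ᶠ[𝓝 x] partialDeriv A G :=
  h.eventuallyEq_nhds.mono fun _ hy => partialDeriv_congr hy A

/-- Even derivatives act on the base point and `L` on the values. Applied to the involution this
gives parity of derivatives, applied to a contraction the commutation of even and odd derivatives.
-/
lemma evenPartial_linear_comp (L : Grassmann β →ₗ[ℝ] Grassmann γ) {F : SuperFn α β} {x : α → ℝ}
    (hF : DifferentiableAt ℝ F x) (a : α) :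
    evenPartial a (fun y => L (F y)) x = L (evenPartial a F x) := by
  rw [evenPartial_apply hF, evenPartial_apply (differentiableAt_linear_comp L hF)]
  have h : HasFDerivAt (fun z => L (F z)) ((clm L).comp (fderiv ℝ F x)) x :=
    (clm L).hasFDerivAt.comp x hF.hasFDerivAt
  rw [h.fderiv]; rfl

lemma contDiffAt_partialDeriv {F : SuperFn α β} {x : α → ℝ} (hF : ContDiffAt ℝ ∞ F x)
    (A : α ⊕ β) : ContDiffAt ℝ ∞ (partialDeriv A F) x := by
  cases A with
  | inl a =>
    refine ContDiffAt.congr_of_eventuallyEq ?_ (evenPartial_eventuallyEq hF a)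
    exact (hF.fderiv_right (m := ∞) (by simp)).clm_apply contDiffAt_const
  | inr j => exact contDiffAt_linear_comp _ hF

lemma contDiffAt_evenPartial {F : SuperFn α β} {x : α → ℝ} (hF : ContDiffAt ℝ ∞ F x)
    (a : α) : ContDiffAt ℝ ∞ (evenPartial a F) x :=
  contDiffAt_partialDeriv hF (.inl a)

lemma partialDeriv_add {F G : SuperFn α β} {x : α → ℝ} (hF : DifferentiableAt ℝ F x)
    (hG : DifferentiableAt ℝ G x) (A : α ⊕ β) :
    partialDeriv A (F + G) x = partialDeriv A F x + partialDeriv A G x := by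
  cases A with
  | inl a =>
    simp only [partialDeriv]
    rw [evenPartial_apply hF, evenPartial_apply hG, evenPartial_apply (hF.add hG),
      fderiv_add hF hG]
    rfl
  | inr j => simp [partialDeriv, oddPartial]

lemma partialDeriv_smul (c : ℝ) {F : SuperFn α β} {x : α → ℝ} (hF : DifferentiableAt ℝ F x)
    (A : α ⊕ β) : partialDeriv A (c • F) x = c • partialDeriv A F x := by
  cases A with
  | inl a =>
    simp only [partialDeriv]
    rw [evenPartial_apply hF, evenPartial_apply (hF.const_smul c), fderiv_const_smul hF]
    rfl
  | inr j => simp [partialDeriv, oddPartial]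

lemma partialDeriv_const_zero (A : α ⊕ β) (x : α → ℝ) :
    partialDeriv A (0 : SuperFn α β) x = 0 := by
  have h := partialDeriv_smul 0 (differentiableAt_const (0 : Grassmann β) (x := x)) A
  rwa [zero_smul, zero_smul] at h

lemma partialDeriv_sum {ι : Type*} (s : Finset ι) {F : ι → SuperFn α β} {x : α → ℝ}
    (hF : ∀ i ∈ s, DifferentiableAt ℝ (F i) x) (A : α ⊕ β) :
    partialDeriv A (∑ i ∈ s, F i) x = ∑ i ∈ s, partialDeriv A (F i) x := by
  classical
  induction s using Finset.induction_on with
  | empty => simpa using partialDeriv_const_zero A x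
  | insert i s hi ih =>
    have hs : ∀ k ∈ s, DifferentiableAt ℝ (F k) x :=
      fun k hk => hF k (Finset.mem_insert_of_mem hk)
    rw [Finset.sum_insert hi, Finset.sum_insert hi, partialDeriv_add
      (hF i (Finset.mem_insert_self i s)) (DifferentiableAt.sum hs), ih hs]

open Grassmann in
/-- The Leibniz rule. -/
lemma partialDeriv_mul {F G : SuperFn α β} {x : α → ℝ} (hF : DifferentiableAt ℝ F x)
    (hG : DifferentiableAt ℝ G x) (A : α ⊕ β) :
    partialDeriv A (F * G) x =
      partialDeriv A F x * G x + parityAut (coordParity A) (F x) * partialDeriv A G x := by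
  cases A with
  | inl a =>
    simp only [partialDeriv, coordParity, parityAut_zero]
    rw [evenPartial_apply hF, evenPartial_apply hG, evenPartial_apply (hF.mul hG),
      fderiv_mul' hF hG]
    simp [add_comm]
  | inr j =>
    simp only [partialDeriv, coordParity, parityAut_one, oddPartial, Pi.mul_apply]
    exact contractLeft_mul _ _ _

lemma SmoothOn.partialDeriv {F : SuperFn α β} {U : Set (α → ℝ)} (hU : IsOpen U)
    (hF : F.SmoothOn U) (A : α ⊕ β) : (partialDeriv A F).SmoothOn U :=
  smoothOn_iff.2 fun _ hx => (contDiffAt_partialDeriv (hF.contDiffAt hU hx) A).contDiffWithinAt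

lemma partialDeriv_mem {F : SuperFn α β} {ε : ZMod 2} {x : α → ℝ}
    (h : ∀ᶠ y in 𝓝 x, F y ∈ Grassmann.ofParity β ε) (hF : DifferentiableAt ℝ F x) (A : α ⊕ β) :
    partialDeriv A F x ∈ Grassmann.ofParity β (ε + coordParity A) := by
  cases A with
  | inr j => exact Grassmann.contractLeft_mem h.self_of_nhds
  | inl a =>
    have hL := evenPartial_linear_comp
      (CliffordAlgebra.involute (Q := (0 : QuadraticForm ℝ (β → ℝ)))).toLinearMap hF a
    simp only [coordParity, add_zero, partialDeriv]
    obtain rfl | rfl := ZMod.two_cases ε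
    · refine Grassmann.mem_even_iff.2 ?_
      rw [← AlgHom.toLinearMap_apply, ← hL]
      refine evenPartial_congr ?_ a
      filter_upwards [h] with y hy
      exact Grassmann.mem_even_iff.1 hy
    · refine Grassmann.mem_odd_iff.2 ?_
      rw [← AlgHom.toLinearMap_apply, ← hL]
      -- An odd function is a -1 eigenvector of the involution, so its derivative is one as well.
      have h2 := partialDeriv_smul (-1) hF (.inl a)
      simp only [partialDeriv, neg_smul, one_smul] at h2
      rw [← h2]
      refine evenPartial_congr ?_ a
      filter_upwards [h] with y hy
      exact Grassmann.mem_odd_iff.1 hy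

lemma HasParityOn.partialDeriv {F : SuperFn α β} {ε : ZMod 2} {U : Set (α → ℝ)} (hU : IsOpen U)
    (h : F.HasParityOn ε U) (hF : F.SmoothOn U) (A : α ⊕ β) :
    (partialDeriv A F).HasParityOn (ε + coordParity A) U := fun _ hx =>
  partialDeriv_mem ((hU.eventually_mem hx).mono h) (hF.contDiffAt hU hx).differentiableAt_top A

/-- Symmetry of the second Fréchet derivative. -/
lemma evenPartial_comm {F : SuperFn α β} {x : α → ℝ} (hF : ContDiffAt ℝ 2 F x) (a b : α) :
    evenPartial a (evenPartial b F) x = evenPartial b (evenPartial a F) x := by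
  have hF' : DifferentiableAt ℝ (fderiv ℝ F) x :=
    (hF.fderiv_right (m := 1) (by norm_num)).differentiableAt (by simp)
  have hd : ∀ᶠ y in 𝓝 x, DifferentiableAt ℝ F y :=
    (hF.eventually (by simp)).mono fun _ hy => hy.differentiableAt (by simp)
  have key : ∀ a b : α, evenPartial a (evenPartial b F) x =
      fderiv ℝ (fderiv ℝ F) x (Pi.single a 1) (Pi.single b 1) := by
    intro a b
    have he : evenPartial b F =ᶠ[𝓝 x] fun y => fderiv ℝ F y (Pi.single b 1) :=
      hd.mono fun _ hy => evenPartial_apply hy b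
    rw [evenPartial_congr he a,
      evenPartial_apply (hF'.clm_apply (differentiableAt_const _)),
      fderiv_clm_apply hF' (differentiableAt_const _)]
    simp
  rw [key, key]
  exact (hF.isSymmSndFDerivAt (by simp)) _ _

lemma evenPartial_partialDeriv_comm {F : SuperFn α β} {x : α → ℝ} (hF : ContDiffAt ℝ ∞ F x)
    (a : α) (B : α ⊕ β) :
    evenPartial a (partialDeriv B F) =ᶠ[𝓝 x] partialDeriv B (evenPartial a F) := by
  cases B with
  | inl b =>
    have h2 : ContDiffAt ℝ 2 F x :=
      hF.of_le (by simpa using WithTop.coe_le_coe.2 (le_top : (2 : ℕ∞) ≤ ⊤))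
    exact (h2.eventually (by simp)).mono fun y hy => evenPartial_comm hy a b
  | inr j =>
    exact hF.eventually_differentiableAt.mono fun y hy => evenPartial_linear_comp _ hy a

section coord

variable [DecidableEq β]

omit [DecidableEq α] in
lemma contDiff_coord (A : α ⊕ β) : ContDiff ℝ ∞ (coord A : SuperFn α β) := by
  cases A with
  | inl a =>
    exact (algebraMapCLM ℝ (Grassmann β)).contDiff.comp (contDiff_apply ℝ ℝ a)
  | inr j => exact contDiff_const

omit [Fintype α] [Fintype β] [DecidableEq α] in
lemma coord_mem (A : α ⊕ β) (x : α → ℝ) :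
    (coord A x : Grassmann β) ∈ Grassmann.ofParity β (coordParity A) := by
  cases A with
  | inl a => exact Grassmann.algebraMap_mem _
  | inr j => exact Grassmann.ι_mem _

lemma partialDeriv_coord (A B : α ⊕ β) (x : α → ℝ) :
    partialDeriv A (coord B : SuperFn α β) x = if A = B then 1 else 0 := by
  have hd := (contDiff_coord B).contDiffAt.differentiableAt_top (x := x)
  cases A with
  | inl a =>
    simp only [partialDeriv]
    rw [evenPartial_apply hd]
    cases B with
    | inl b =>
      have h : HasFDerivAt (coord (.inl b) : SuperFn α β)
          ((algebraMapCLM ℝ (Grassmann β)).comp (ContinuousLinearMap.proj b)) x :=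
        (algebraMapCLM ℝ (Grassmann β)).hasFDerivAt.comp x
          (ContinuousLinearMap.proj (R := ℝ) (φ := fun _ : α => ℝ) b).hasFDerivAt
      rw [h.fderiv]
      by_cases hab : a = b
      · subst hab; simp
      · have : b ≠ a := fun h => hab h.symm
        simp [hab, this]
    | inr j => simp [coord]
  | inr j =>
    cases B with
    | inl b => simp [partialDeriv, oddPartial, coord, CliffordAlgebra.contractLeft_algebraMap]
    | inr k =>
      simp only [partialDeriv, oddPartial, coord]
      rw [CliffordAlgebra.contractLeft_ι]
      by_cases hab : j = k
      · subst hab; simp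
      · simp [hab]

end coord

end SuperFn

/-! ### Pullback as an algebra morphism. -/

namespace SuperMap

open SuperFn Grassmann

variable {α β α' β' : Type} [Fintype α'] [DecidableEq α'] [Fintype β']
  {φ : SuperMap α β α' β'} {x : α → ℝ}

lemma taylorTerm_congr (k : ℕ) {F G : SuperFn α' β'} (h : F =ᶠ[𝓝 (φ.body x)] G) :
    taylorTerm φ k F x = taylorTerm φ k G x := by
  induction k generalizing F G with
  | zero => simp only [taylorTerm, h.eq_of_nhds]
  | succ k ih =>
    simp only [taylorTerm]
    refine Finset.sum_congr rfl fun a _ => ?_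
    congr 1
    exact ih (partialDeriv_eventuallyEq h (.inl a))

lemma taylorTerm_add (k : ℕ) {F G : SuperFn α' β'} (hF : ContDiffAt ℝ ∞ F (φ.body x))
    (hG : ContDiffAt ℝ ∞ G (φ.body x)) :
    taylorTerm φ k (F + G) x = taylorTerm φ k F x + taylorTerm φ k G x := by
  induction k generalizing F G with
  | zero => simp [taylorTerm]
  | succ k ih =>
    simp only [taylorTerm, ← Finset.sum_add_distrib, ← add_mul]
    refine Finset.sum_congr rfl fun a _ => ?_
    rw [← ih (contDiffAt_evenPartial hF a) (contDiffAt_evenPartial hG a)]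
    congr 1
    refine taylorTerm_congr k ?_
    filter_upwards [hF.eventually_differentiableAt, hG.eventually_differentiableAt] with y h1 h2
    exact partialDeriv_add h1 h2 (.inl a)

lemma taylorTerm_zero (k : ℕ) : taylorTerm φ k 0 x = 0 := by
  have h := taylorTerm_add (φ := φ) (x := x) k (F := 0) (G := 0) contDiffAt_const contDiffAt_const
  rw [add_zero] at h
  exact left_eq_add.1 h

/-- Each order of the expansion contributes one further soul, of degree at least one. -/
lemma taylorTerm_mem_degreeGE (k : ℕ) (F : SuperFn α' β') :
    taylorTerm φ k F x ∈ degreeGE β k := by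
  induction k generalizing F with
  | zero => simp [degreeGE_zero]
  | succ k ih =>
    exact Submodule.sum_mem _ fun a _ => mul_mem_degreeGE (ih _) (soul_mem_degreeGE _)

lemma taylorTerm_mem (k : ℕ) {F : SuperFn α' β'} {ε : ZMod 2} {V : Set (α' → ℝ)} (hV : IsOpen V)
    (hF : F.SmoothOn V) (hFε : F.HasParityOn ε V) (hx : φ.body x ∈ V)
    (hφ : ∀ A, φ A x ∈ ofParity β (coordParity A)) :
    taylorTerm φ k F x ∈ ofParity β ε := by
  induction k generalizing F with
  | zero => exact subst_mem (fun j => hφ (.inr j)) (hFε _ hx)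
  | succ k ih =>
    refine Submodule.sum_mem _ fun a _ => ?_
    rw [← add_zero ε]
    have h := hFε.partialDeriv hV hF (.inl a)
    simp only [coordParity, add_zero] at h
    exact mul_mem (ih (hF.partialDeriv hV (.inl a)) h) (soul_even (hφ (.inl a)))

/-- This is the binomial form of the Leibniz rule. Even derivatives satisfy the unsigned rule, and
souls of even components are central, so they can be attached to either factor. -/
lemma taylorTerm_mul (k : ℕ) {F G : SuperFn α' β'} (hF : ContDiffAt ℝ ∞ F (φ.body x))
    (hG : ContDiffAt ℝ ∞ G (φ.body x)) (hφ : ∀ a, φ (.inl a) x ∈ ofParity β 0) :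
    taylorTerm φ k (F * G) x = ∑ p ∈ Finset.HasAntidiagonal.antidiagonal k,
      k.choose p.1 • (taylorTerm φ p.1 F x * taylorTerm φ p.2 G x) := by
  induction k generalizing F G with
  | zero => simp [taylorTerm]
  | succ k ih =>
    -- Pascal's rule splits order `k + 1` according to which factor receives the extra derivative;
    -- `h2` and `h3` identify the two halves.
    rw [Finset.sum_antidiagonal_choose_succ_nsmul
      (fun i j => taylorTerm φ i F x * taylorTerm φ j G x) k]
    have h1 : ∀ a, taylorTerm φ k (evenPartial a (F * G)) x =
        taylorTerm φ k (evenPartial a F * G) x + taylorTerm φ k (F * evenPartial a G) x := by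
      intro a
      rw [← taylorTerm_add k (contDiffAt_mul (contDiffAt_evenPartial hF a) hG)
        (contDiffAt_mul hF (contDiffAt_evenPartial hG a))]
      refine taylorTerm_congr k ?_
      filter_upwards [hF.eventually_differentiableAt, hG.eventually_differentiableAt] with y h1 h2
      simpa [coordParity, partialDeriv] using partialDeriv_mul h1 h2 (.inl a)
    have h2 : ∀ p ∈ Finset.HasAntidiagonal.antidiagonal k,
        k.choose p.2 • (taylorTerm φ (p.1 + 1) F x * taylorTerm φ p.2 G x) =
          ∑ a, k.choose p.1 • (taylorTerm φ p.1 (evenPartial a F) x * taylorTerm φ p.2 G x) *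
            (φ (.inl a) x).soul := by
      intro p hp
      rw [← Nat.choose_symm_of_eq_add (Finset.HasAntidiagonal.mem_antidiagonal.1 hp).symm]
      simp only [taylorTerm, Finset.sum_mul, Finset.smul_sum, smul_mul_assoc]
      refine Finset.sum_congr rfl fun a _ => ?_
      rw [mul_assoc, ← even_mul_comm (soul_even (hφ a)), ← mul_assoc]
    have h3 : ∀ p ∈ Finset.HasAntidiagonal.antidiagonal k,
        k.choose p.1 • (taylorTerm φ p.1 F x * taylorTerm φ (p.2 + 1) G x) =
          ∑ a, k.choose p.1 • (taylorTerm φ p.1 F x * taylorTerm φ p.2 (evenPartial a G) x) *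
            (φ (.inl a) x).soul := by
      intro p hp
      simp only [taylorTerm, Finset.mul_sum, Finset.smul_sum, smul_mul_assoc, mul_assoc]
    rw [Finset.sum_congr rfl h2, Finset.sum_congr rfl h3, Finset.sum_comm,
      Finset.sum_comm (s := Finset.HasAntidiagonal.antidiagonal k), ← Finset.sum_add_distrib]
    simp only [taylorTerm]
    refine Finset.sum_congr rfl fun a _ => ?_
    rw [h1, ih (contDiffAt_evenPartial hF a) hG, ih hF (contDiffAt_evenPartial hG a), add_mul,
      Finset.sum_mul, Finset.sum_mul, add_comm]

lemma taylorTerm_succ_eq_zero (k : ℕ) {F : SuperFn α' β'}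
    (hF : ∀ a, evenPartial a F =ᶠ[𝓝 (φ.body x)] 0) : taylorTerm φ (k + 1) F x = 0 := by
  simp only [taylorTerm]
  refine Finset.sum_eq_zero fun a _ => ?_
  rw [taylorTerm_congr k (hF a), taylorTerm_zero, zero_mul]

variable [Fintype β]

lemma taylorTerm_eq_zero {k : ℕ} (hk : Fintype.card β < k) (F : SuperFn α' β') :
    taylorTerm φ k F x = 0 := by
  have h := taylorTerm_mem_degreeGE (φ := φ) (x := x) k F
  rwa [degreeGE_eq_bot hk, Submodule.mem_bot] at h

lemma pullback_add {F G : SuperFn α' β'} (hF : ContDiffAt ℝ ∞ F (φ.body x))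
    (hG : ContDiffAt ℝ ∞ G (φ.body x)) :
    φ.pullback (F + G) x = φ.pullback F x + φ.pullback G x := by
  simp only [pullback, taylorTerm_add _ hF hG, smul_add, Finset.sum_add_distrib]

lemma pullback_zero : φ.pullback 0 x = 0 := by
  simp [pullback, taylorTerm_zero]

lemma pullback_sum {ι : Type*} (s : Finset ι) {F : ι → SuperFn α' β'}
    (hF : ∀ i ∈ s, ContDiffAt ℝ ∞ (F i) (φ.body x)) :
    φ.pullback (∑ i ∈ s, F i) x = ∑ i ∈ s, φ.pullback (F i) x := by
  classical
  induction s using Finset.induction_on with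
  | empty => simpa using pullback_zero
  | insert i s hi ih =>
    have hs : ∀ k ∈ s, ContDiffAt ℝ ∞ (F k) (φ.body x) :=
      fun k hk => hF k (Finset.mem_insert_of_mem hk)
    rw [Finset.sum_insert hi, Finset.sum_insert hi,
      pullback_add (hF i (Finset.mem_insert_self i s)) (contDiffAt_sum s hs), ih hs]

lemma pullback_mem {F : SuperFn α' β'} {ε : ZMod 2} {V : Set (α' → ℝ)} (hV : IsOpen V)
    (hF : F.SmoothOn V) (hFε : F.HasParityOn ε V) (hx : φ.body x ∈ V)
    (hφ : ∀ A, φ A x ∈ ofParity β (coordParity A)) :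
    φ.pullback F x ∈ ofParity β ε :=
  Submodule.sum_mem _ fun k _ => Submodule.smul_mem _ _ (taylorTerm_mem k hV hF hFε hx hφ)

/-- The pullback is multiplicative. -/
lemma pullback_mul {F G : SuperFn α' β'} (hF : ContDiffAt ℝ ∞ F (φ.body x))
    (hG : ContDiffAt ℝ ∞ G (φ.body x)) (hφ : ∀ a, φ (.inl a) x ∈ ofParity β 0) :
    φ.pullback (F * G) x = φ.pullback F x * φ.pullback G x := by
  set N := Fintype.card β + 1
  let g : ℕ × ℕ → Grassmann β := fun p =>
    ((p.1.factorial : ℝ)⁻¹ • taylorTerm φ p.1 F x) * ((p.2.factorial : ℝ)⁻¹ • taylorTerm φ p.2 G x)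
  -- The product of terms of orders `p.1` and `p.2` has degree at least `p.1 + p.2`, so the square
  -- of index pairs in a product of two truncated series reduces to the triangle cut into
  -- antidiagonals below.
  have hg : ∀ p : ℕ × ℕ, g p ≠ 0 → p.1 + p.2 < N := by
    intro p hp
    by_contra hlt
    refine hp ?_
    have h := mul_mem_degreeGE (taylorTerm_mem_degreeGE (φ := φ) (x := x) p.1 F)
      (taylorTerm_mem_degreeGE (φ := φ) (x := x) p.2 G)
    rw [degreeGE_eq_bot (by omega), Submodule.mem_bot] at h
    simp only [g, smul_mul_smul_comm, h, smul_zero]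
  have h1 : φ.pullback F x * φ.pullback G x =
      ∑ p ∈ (Finset.range N ×ˢ Finset.range N) with p.1 + p.2 < N, g p := by
    rw [Finset.sum_filter_of_ne fun p _ => hg p, Finset.sum_product]
    simp only [pullback, Finset.sum_mul_sum, g, N]
  have h2 : ∀ k ∈ Finset.range N, ((k.factorial : ℝ)⁻¹) • taylorTerm φ k (F * G) x =
      ∑ p ∈ Finset.HasAntidiagonal.antidiagonal k, g p := by
    intro k _
    rw [taylorTerm_mul k hF hG hφ, Finset.smul_sum]
    refine Finset.sum_congr rfl fun p hp => ?_
    obtain rfl := Finset.HasAntidiagonal.mem_antidiagonal.1 hp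
    simp only [g, smul_mul_smul_comm]
    rw [← Nat.cast_smul_eq_nsmul ℝ, smul_smul]
    congr 1
    rw [Nat.cast_add_choose]
    have := Nat.factorial_ne_zero (p.1 + p.2)
    field_simp
  rw [h1, ← Finset.sum_fiberwise_of_maps_to (t := Finset.range N) (g := fun p => p.1 + p.2)
    (fun p hp => by simpa using (Finset.mem_filter.1 hp).2)]
  rw [pullback, Finset.sum_congr rfl h2]
  refine Finset.sum_congr rfl fun k hk => Finset.sum_congr ?_ fun _ _ => rfl
  ext p
  simp only [Finset.mem_filter, Finset.mem_product, Finset.mem_range,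
    Finset.HasAntidiagonal.mem_antidiagonal] at hk ⊢
  omega

/-- A coordinate is affine: for an even one, order zero yields the body, order one the soul, and
higher orders vanish. An odd coordinate is recovered at order zero. -/
lemma pullback_coord [DecidableEq β'] (hφ : ∀ j, φ (.inr j) x ∈ ofParity β 1) (A : α' ⊕ β') :
    φ.pullback (coord A) x = φ A x := by
  cases A with
  | inr j =>
    have h : ∀ k, taylorTerm φ (k + 1) (coord (.inr j)) x = 0 := fun k =>
      taylorTerm_succ_eq_zero k fun a => Eventually.of_forall fun y => by
        simpa [partialDeriv] using partialDeriv_coord (.inl a) (.inr j : α' ⊕ β') y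
    rw [pullback, Finset.sum_range_succ']
    simp only [h, smul_zero, Finset.sum_const_zero, zero_add]
    simp [taylorTerm, coord, subst_ι hφ, Pi.single_apply]
  | inl a =>
    have h1 : ∀ k b, taylorTerm φ k (evenPartial b (coord (.inl a))) x =
        if k = 0 ∧ b = a then 1 else 0 := by
      intro k b
      have hb : evenPartial b (coord (.inl a) : SuperFn α' β') =
          fun _ => if b = a then 1 else 0 := by
        funext y
        simpa [partialDeriv] using partialDeriv_coord (.inl b) (.inl a : α' ⊕ β') y
      rw [hb]
      cases k with
      | zero => simp only [taylorTerm]; split_ifs <;> simp_all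
      | succ k =>
        rw [taylorTerm_succ_eq_zero k]
        · simp
        · intro c
          refine Eventually.of_forall fun y => ?_
          rw [evenPartial_apply (differentiableAt_const _)]
          simp
    have h2 : ∀ k, taylorTerm φ (k + 1) (coord (.inl a)) x =
        if k = 0 then (φ (.inl a) x).soul else 0 := by
      intro k
      simp only [taylorTerm, h1]
      by_cases hk : k = 0 <;> simp [hk]
    have h0 : taylorTerm φ 0 (coord (.inl a)) x =
        algebraMap ℝ (Grassmann β) (φ (.inl a) x).body := by
      simp only [taylorTerm, coord, AlgHom.commutes]; rfl
    rw [pullback, Finset.sum_range_succ', h0]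
    simp only [h2]
    conv_rhs => rw [← sub_add_cancel (φ (.inl a) x)
      (algebraMap ℝ (Grassmann β) (Grassmann.body (φ (.inl a) x)))]
    simp only [Nat.factorial_zero, Nat.cast_one, inv_one, one_smul]
    congr 1
    change _ = (φ (.inl a) x).soul
    -- Without odd coordinates the truncated sum stops before order one, but then the soul is zero.
    obtain hN | ⟨N, hN⟩ : Fintype.card β = 0 ∨ ∃ N, Fintype.card β = N + 1 := by
      cases Fintype.card β <;> simp
    · have h := soul_mem_degreeGE (φ (.inl a) x)
      rw [degreeGE_eq_bot (by omega), Submodule.mem_bot] at h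
      simp [h]
    · rw [hN, Finset.sum_eq_single 0 (by simp +contextual) (by simp)]
      simp

end SuperMap

namespace Grassmann

variable {β : Type}

/-- Moving a derivative past the element it is applied after. -/
lemma parityAut_mul_comm {ε δ : ZMod 2} (a : Grassmann β) {h : Grassmann β}
    (hh : h ∈ ofParity β (ε + δ)) : parityAut ε a * h = h * parityAut δ a := by
  rw [mul_comm_of_mem hh]
  obtain rfl | rfl := ZMod.two_cases ε <;> obtain rfl | rfl := ZMod.two_cases δ <;>
    simp [show (1 + 1 : ZMod 2) = 0 from rfl]

end Grassmann


/-! ### The chain rule for pullbacks. -/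

namespace SuperMap

open SuperFn Grassmann

variable {α β α' β' : Type} [Fintype α] [DecidableEq α] [Fintype β]
  {φ : SuperMap α β α' β'} {x : α → ℝ}

/-- The map `φ` is smooth at `x` and has components of the appropriate parity near `x`. -/
structure IsRegularAt (φ : SuperMap α β α' β') (x : α → ℝ) : Prop where
  smooth : ∀ A, ContDiffAt ℝ ∞ (φ A) x
  parity : ∀ A, ∀ᶠ y in 𝓝 x, φ A y ∈ ofParity β (coordParity A)

lemma IsRegularAt.mem (h : φ.IsRegularAt x) (A : α' ⊕ β') :
    φ A x ∈ ofParity β (coordParity A) := (h.parity A).self_of_nhds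

lemma IsRegularAt.partialDeriv_mem (h : φ.IsRegularAt x) (C : α ⊕ β) (A : α' ⊕ β') :
    SuperFn.partialDeriv C (φ A) x ∈ ofParity β (coordParity A + coordParity C) :=
  SuperFn.partialDeriv_mem (h.parity A) (h.smooth A).differentiableAt_top C

/-- The body of an even component, as a superfunction. -/
def bodyFn (φ : SuperMap α β α' β') (a : α') : SuperFn α β :=
  fun x => algebraMap ℝ _ (φ.body x a)

/-- The soul of an even component, as a superfunction. -/
def soulFn (φ : SuperMap α β α' β') (a : α') : SuperFn α β :=
  fun x => (φ (.inl a) x).soul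

lemma bodyFn_add_soulFn (a : α') : φ.bodyFn a + φ.soulFn a = φ (.inl a) := by
  funext x
  exact add_sub_cancel (algebraMap ℝ (Grassmann β) (φ.body x a)) (φ (.inl a) x)

lemma IsRegularAt.contDiffAt_body (h : φ.IsRegularAt x) (a : α') :
    ContDiffAt ℝ ∞ (fun y => φ.body y a) x :=
  (LinearMap.toContinuousLinearMap
    (ExteriorAlgebra.algebraMapInv (R := ℝ) (M := β → ℝ)).toLinearMap).contDiff.contDiffAt.comp x
      (h.smooth (.inl a))

lemma IsRegularAt.contDiffAt_bodyFn (h : φ.IsRegularAt x) (a : α') :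
    ContDiffAt ℝ ∞ (φ.bodyFn a) x :=
  (algebraMapCLM ℝ (Grassmann β)).contDiff.contDiffAt.comp x (h.contDiffAt_body a)

lemma IsRegularAt.contDiffAt_soulFn (h : φ.IsRegularAt x) (a : α') :
    ContDiffAt ℝ ∞ (φ.soulFn a) x :=
  (h.smooth (.inl a)).sub (h.contDiffAt_bodyFn a)

lemma partialDeriv_algebraMap_comp {f : (α → ℝ) → ℝ} (hf : DifferentiableAt ℝ f x) (C : α ⊕ β) :
    SuperFn.partialDeriv C (fun y => algebraMap ℝ (Grassmann β) (f y)) x =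
      algebraMap ℝ (Grassmann β) (Sum.elim (fun c => fderiv ℝ f x (Pi.single c 1)) 0 C) := by
  cases C with
  | inl c =>
    have h : HasFDerivAt (fun y => algebraMap ℝ (Grassmann β) (f y))
        ((algebraMapCLM ℝ (Grassmann β)).comp (fderiv ℝ f x)) x :=
      (algebraMapCLM ℝ (Grassmann β)).hasFDerivAt.comp x hf.hasFDerivAt
    simp only [SuperFn.partialDeriv]
    rw [evenPartial_apply h.differentiableAt, h.fderiv]
    rfl
  | inr j =>
    simp [SuperFn.partialDeriv, oddPartial, CliffordAlgebra.contractLeft_algebraMap]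

variable [Fintype α'] [DecidableEq α'] [Fintype β']

lemma IsRegularAt.contDiffAt_bodyMap (h : φ.IsRegularAt x) : ContDiffAt ℝ ∞ φ.body x :=
  contDiffAt_pi.2 h.contDiffAt_body

/-- The ordinary chain rule through the body map. For an odd `C` both sides vanish, as only
scalar-valued functions are differentiated. -/
lemma IsRegularAt.partialDeriv_comp_body (h : φ.IsRegularAt x) {f : (α' → ℝ) → ℝ}
    (hf : DifferentiableAt ℝ f (φ.body x)) (C : α ⊕ β) :
    SuperFn.partialDeriv C (fun y => algebraMap ℝ (Grassmann β) (f (φ.body y))) x =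
      ∑ a, SuperFn.partialDeriv C (φ.bodyFn a) x *
        algebraMap ℝ (Grassmann β) (lineDeriv ℝ f (φ.body x) (Pi.single a 1)) := by
  have hb := h.contDiffAt_bodyMap.differentiableAt (by simp)
  have hba := fun a => (h.contDiffAt_body a).differentiableAt (by simp)
  have hcomp : HasFDerivAt (fun y => f (φ.body y))
      ((fderiv ℝ f (φ.body x)).comp (fderiv ℝ φ.body x)) x :=
    hf.hasFDerivAt.comp x hb.hasFDerivAt
  rw [partialDeriv_algebraMap_comp hcomp.differentiableAt]
  have h2 : ∀ a, SuperFn.partialDeriv C (φ.bodyFn a) x = _ :=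
    fun a => partialDeriv_algebraMap_comp (hba a) C
  simp only [h2, ← map_mul, ← map_sum]
  congr 1
  cases C with
  | inr j => simp
  | inl c =>
    simp only [Sum.elim_inl, hcomp.fderiv, ContinuousLinearMap.comp_apply]
    have h3 : fderiv ℝ φ.body x (Pi.single c 1) =
        ∑ a, fderiv ℝ (fun y => φ.body y a) x (Pi.single c 1) • (Pi.single a 1 : α' → ℝ) := by
      rw [fderiv_pi hba]
      ext b
      simp [Finset.sum_apply, Pi.single_apply]
    rw [h3, map_sum]
    refine Finset.sum_congr rfl fun a _ => ?_
    rw [map_smul, smul_eq_mul, (hf.hasFDerivAt.hasLineDerivAt _).lineDeriv]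

/-- The derivative of a substitution into a constant. -/
lemma IsRegularAt.subst_const (h : φ.IsRegularAt x) (e : Grassmann β') :
    ContDiffAt ℝ ∞ (fun y => subst (fun j => φ (.inr j) y) e) x ∧
    ∀ C, SuperFn.partialDeriv C (fun y => subst (fun j => φ (.inr j) y) e) x =
      ∑ j, SuperFn.partialDeriv C (φ (.inr j)) x * subst (fun j => φ (.inr j) x)
        (CliffordAlgebra.contractLeft (LinearMap.proj j : Module.Dual ℝ (β' → ℝ)) e) := by
  have hodd : ∀ᶠ y in 𝓝 x, ∀ j, φ (.inr j) y ∈ ofParity β 1 :=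
    eventually_all.2 fun j => h.parity (.inr j)
  induction e using ExteriorAlgebra.induction with
  | algebraMap r =>
    simp only [AlgHom.commutes]
    refine ⟨contDiffAt_const, fun C => ?_⟩
    have h1 := partialDeriv_algebraMap_comp (differentiableAt_const r (x := x)) C
    rw [h1]
    cases C <;> simp [CliffordAlgebra.contractLeft_algebraMap]
  | ι w =>
    have he : (fun y => subst (fun j => φ (.inr j) y) (ExteriorAlgebra.ι ℝ w)) =ᶠ[𝓝 x]
        ∑ j, w j • φ (.inr j) := by
      filter_upwards [hodd] with y hy
      rw [subst_ι hy]
      simp [Finset.sum_apply]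
    have hs : ∀ j ∈ Finset.univ, ContDiffAt ℝ ∞ (w j • φ (.inr j)) x :=
      fun j _ => contDiffAt_const.smul (h.smooth (.inr j))
    refine ⟨(contDiffAt_sum _ hs).congr_of_eventuallyEq he, fun C => ?_⟩
    rw [partialDeriv_congr he, partialDeriv_sum _ fun j hj => (hs j hj).differentiableAt_top]
    refine Finset.sum_congr rfl fun j _ => ?_
    rw [partialDeriv_smul _ (h.smooth (.inr j)).differentiableAt_top,
      CliffordAlgebra.contractLeft_ι, AlgHom.commutes, ← Algebra.commutes, Algebra.smul_def]
    rfl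
  | add a b ha hb =>
    simp only [map_add]
    refine ⟨ha.1.add hb.1, fun C => ?_⟩
    have := partialDeriv_add ha.1.differentiableAt_top hb.1.differentiableAt_top C
    simp only [mul_add, Finset.sum_add_distrib, ← ha.2 C, ← hb.2 C]
    exact this
  | mul a b ha hb =>
    simp only [map_mul]
    refine ⟨ha.1.mul hb.1, fun C => ?_⟩
    have := partialDeriv_mul ha.1.differentiableAt_top hb.1.differentiableAt_top C
    refine this.trans ?_
    rw [ha.2 C, hb.2 C, Finset.sum_mul, Finset.mul_sum, ← Finset.sum_add_distrib]
    refine Finset.sum_congr rfl fun j _ => ?_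
    rw [contractLeft_mul, map_add, map_mul, map_mul, mul_add, ← mul_assoc, ← mul_assoc,
      ← mul_assoc]
    congr 2
    -- The derivative of an odd component has parity one more than that of `C`. Moving it past the
    -- substituted factor therefore turns the sign of the derivative along `C` into the grade
    -- involution demanded by the Leibniz rule for contraction.
    have hm := h.partialDeriv_mem C (.inr j)
    rw [add_comm] at hm
    rw [parityAut_mul_comm _ hm, subst_involute fun j => h.mem (.inr j)]
    simp [coordParity]

/-- The derivative of the zeroth Taylor term. -/
lemma IsRegularAt.taylorTerm_zero (h : φ.IsRegularAt x) {F : SuperFn α' β'}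
    (hF : ContDiffAt ℝ ∞ F (φ.body x)) :
    ContDiffAt ℝ ∞ (taylorTerm φ 0 F) x ∧
    ∀ C, SuperFn.partialDeriv C (taylorTerm φ 0 F) x =
      ∑ a, SuperFn.partialDeriv C (φ.bodyFn a) x * taylorTerm φ 0 (evenPartial a F) x +
      ∑ j, SuperFn.partialDeriv C (φ (.inr j)) x * taylorTerm φ 0 (oddPartial j F) x := by
  -- Expanding `F` in a constant basis separates the two dependences: scalar coefficients composed
  -- with the body map, and substitution into constants.
  let e := Module.finBasis ℝ (Grassmann β')
  let f : Fin (Module.finrank ℝ (Grassmann β')) → (α' → ℝ) → ℝ := fun k z => e.repr (F z) k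
  let A : Fin (Module.finrank ℝ (Grassmann β')) → SuperFn α β :=
    fun k y => algebraMap ℝ (Grassmann β) (f k (φ.body y))
  let B : Fin (Module.finrank ℝ (Grassmann β')) → SuperFn α β :=
    fun k y => subst (fun j => φ (.inr j) y) (e k)
  have hFe : ∀ z, F z = ∑ k, f k z • e k := fun z => (e.sum_repr (F z)).symm
  have hf : ∀ k, ContDiffAt ℝ ∞ (f k) (φ.body x) := fun k =>
    (LinearMap.toContinuousLinearMap (e.coord k)).contDiff.contDiffAt.comp _ hF
  have hA : ∀ k, ContDiffAt ℝ ∞ (A k) x := fun k =>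
    (algebraMapCLM ℝ (Grassmann β)).contDiff.contDiffAt.comp x
      ((hf k).comp x h.contDiffAt_bodyMap)
  have hB : ∀ k, ContDiffAt ℝ ∞ (B k) x := fun k => (h.subst_const (e k)).1
  have hT : taylorTerm φ 0 F = ∑ k, A k * B k := by
    funext y
    simp only [taylorTerm, Finset.sum_apply, Pi.mul_apply, A, B]
    rw [hFe, map_sum]
    refine Finset.sum_congr rfl fun k _ => ?_
    rw [map_smul, Algebra.smul_def]
  have hAB : ∀ k ∈ Finset.univ, ContDiffAt ℝ ∞ (A k * B k) x :=
    fun k _ => contDiffAt_mul (hA k) (hB k)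
  rw [hT]
  refine ⟨contDiffAt_sum _ hAB, fun C => ?_⟩
  rw [partialDeriv_sum _ fun k hk => (hAB k hk).differentiableAt_top]
  have hD : ∀ k, SuperFn.partialDeriv C (A k * B k) x =
      ∑ a, SuperFn.partialDeriv C (φ.bodyFn a) x *
        (lineDeriv ℝ (f k) (φ.body x) (Pi.single a 1) • B k x) +
      ∑ j, SuperFn.partialDeriv C (φ (.inr j)) x *
        subst (fun j => φ (.inr j) x)
          (f k (φ.body x) •
            CliffordAlgebra.contractLeft (LinearMap.proj j : Module.Dual ℝ (β' → ℝ)) (e k)) := by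
    intro k
    rw [partialDeriv_mul (hA k).differentiableAt_top (hB k).differentiableAt_top]
    congr 1
    · rw [h.partialDeriv_comp_body ((hf k).differentiableAt (by simp)), Finset.sum_mul]
      simp only [mul_assoc, Algebra.smul_def]
    · have h1 : parityAut (coordParity C) (A k x) = A k x := AlgHom.commutes _ _
      rw [h1, (h.subst_const (e k)).2 C, Finset.mul_sum]
      refine Finset.sum_congr rfl fun j _ => ?_
      rw [map_smul, mul_smul_comm, Algebra.smul_def]
  simp only [hD, Finset.sum_add_distrib]
  congr 1
  · rw [Finset.sum_comm]
    refine Finset.sum_congr rfl fun a _ => ?_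
    rw [← Finset.mul_sum]
    simp only [taylorTerm, evenPartial, map_sum, map_smul]
    rfl
  · rw [Finset.sum_comm]
    refine Finset.sum_congr rfl fun j _ => ?_
    rw [← Finset.mul_sum]
    simp only [taylorTerm, oddPartial]
    rw [hFe, map_sum, map_sum]
    simp only [map_smul]

/-- The Taylor terms of a smooth function are smooth. -/
lemma IsRegularAt.contDiffAt_taylorTerm (h : φ.IsRegularAt x) (k : ℕ) {F : SuperFn α' β'}
    (hF : ContDiffAt ℝ ∞ F (φ.body x)) : ContDiffAt ℝ ∞ (taylorTerm φ k F) x := by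
  induction k generalizing F with
  | zero => exact (h.taylorTerm_zero hF).1
  | succ k ih =>
    have hk : taylorTerm φ (k + 1) F = ∑ a, taylorTerm φ k (evenPartial a F) * φ.soulFn a := by
      funext y; simp [taylorTerm, soulFn]
    rw [hk]
    exact contDiffAt_sum _ fun a _ =>
      contDiffAt_mul (ih (contDiffAt_evenPartial hF a)) (h.contDiffAt_soulFn a)

lemma IsRegularAt.partialDeriv_soulFn_mem (h : φ.IsRegularAt x) (C : α ⊕ β) (a : α') :
    SuperFn.partialDeriv C (φ.soulFn a) x ∈ ofParity β (coordParity C) := by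
  have hp : ∀ᶠ y in 𝓝 x, φ.soulFn a y ∈ ofParity β 0 :=
    (h.parity (.inl a)).mono fun y hy => soul_even hy
  simpa using SuperFn.partialDeriv_mem hp (h.contDiffAt_soulFn a).differentiableAt_top C

/-- Commuting derivatives brings the outer derivative `B` inside, the form that the induction on the
order produces. -/
lemma taylorTerm_succ_partialDeriv (k : ℕ) {F : SuperFn α' β'}
    (hF : ContDiffAt ℝ ∞ F (φ.body x)) (B : α' ⊕ β') :
    taylorTerm φ (k + 1) (SuperFn.partialDeriv B F) x =
      ∑ b, taylorTerm φ k (SuperFn.partialDeriv B (evenPartial b F)) x * φ.soulFn b x := by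
  refine Finset.sum_congr rfl fun b _ => ?_
  congr 1
  exact taylorTerm_congr k (evenPartial_partialDeriv_comm hF b B)

/-- The derivative of a Taylor term. -/
lemma IsRegularAt.partialDeriv_taylorTerm (h : φ.IsRegularAt x) (C : α ⊕ β) (k : ℕ)
    {F : SuperFn α' β'} (hF : ContDiffAt ℝ ∞ F (φ.body x)) :
    SuperFn.partialDeriv C (taylorTerm φ k F) x =
      ∑ a, SuperFn.partialDeriv C (φ.bodyFn a) x * taylorTerm φ k (evenPartial a F) x +
      ∑ j, SuperFn.partialDeriv C (φ (.inr j)) x * taylorTerm φ k (oddPartial j F) x +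
      (k : ℝ) • ∑ a, SuperFn.partialDeriv C (φ.soulFn a) x *
        taylorTerm φ (k - 1) (evenPartial a F) x := by
  induction k generalizing F with
  | zero => simpa using (h.taylorTerm_zero hF).2 C
  | succ k ih =>
    have hk : taylorTerm φ (k + 1) F = ∑ b, taylorTerm φ k (evenPartial b F) * φ.soulFn b := by
      funext y; simp [taylorTerm, soulFn]
    have hT := fun b => h.contDiffAt_taylorTerm k (contDiffAt_evenPartial hF b)
    have hD : ∀ b, SuperFn.partialDeriv C (taylorTerm φ k (evenPartial b F) * φ.soulFn b) x =
        SuperFn.partialDeriv C (taylorTerm φ k (evenPartial b F)) x * φ.soulFn b x +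
          SuperFn.partialDeriv C (φ.soulFn b) x * taylorTerm φ k (evenPartial b F) x := by
      intro b
      rw [partialDeriv_mul (hT b).differentiableAt_top (h.contDiffAt_soulFn b).differentiableAt_top]
      congr 1
      have hm := h.partialDeriv_soulFn_mem C b
      rw [← add_zero (coordParity C)] at hm
      rw [parityAut_mul_comm _ hm, parityAut_zero]
    -- The `k` earlier souls contribute `k` equal terms; the newly split-off soul will supply the
    -- one that makes `k + 1`. At `k = 0` the truncated index `k - 1` is harmless because of the
    -- factor zero.
    have hV : (k : ℝ) • ∑ b, (∑ a, SuperFn.partialDeriv C (φ.soulFn a) x *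
          taylorTerm φ (k - 1) (evenPartial a (evenPartial b F)) x) * φ.soulFn b x =
        (k : ℝ) • ∑ a, SuperFn.partialDeriv C (φ.soulFn a) x *
          taylorTerm φ k (evenPartial a F) x := by
      cases k with
      | zero => simp
      | succ k =>
        congr 1
        simp only [Finset.sum_mul]
        rw [Finset.sum_comm]
        refine Finset.sum_congr rfl fun a _ => ?_
        have := taylorTerm_succ_partialDeriv (φ := φ) k hF (.inl a)
        simp only [SuperFn.partialDeriv] at this
        rw [this, Finset.mul_sum]
        simp only [mul_assoc, Nat.add_sub_cancel]
    rw [hk, partialDeriv_sum _ fun b _ =>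
      (contDiffAt_mul (hT b) (h.contDiffAt_soulFn b)).differentiableAt_top]
    simp only [hD, Finset.sum_add_distrib]
    simp only [ih (contDiffAt_evenPartial hF _), add_mul, smul_mul_assoc, Finset.sum_add_distrib,
      ← Finset.smul_sum]
    rw [hV, add_assoc]
    congr 1
    · congr 1
      · simp only [Finset.sum_mul]
        rw [Finset.sum_comm]
        refine Finset.sum_congr rfl fun a _ => ?_
        have := taylorTerm_succ_partialDeriv (φ := φ) k hF (.inl a)
        simp only [SuperFn.partialDeriv] at this
        rw [this, Finset.mul_sum]
        simp only [mul_assoc]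
      · simp only [Finset.sum_mul]
        rw [Finset.sum_comm]
        refine Finset.sum_congr rfl fun a _ => ?_
        have := taylorTerm_succ_partialDeriv (φ := φ) k hF (.inr a)
        simp only [SuperFn.partialDeriv] at this
        rw [this, Finset.mul_sum]
        simp only [mul_assoc]
    · simp only [Nat.add_sub_cancel, Nat.cast_add, Nat.cast_one, add_smul, one_smul]

/-- The chain rule. -/
lemma IsRegularAt.partialDeriv_pullback (h : φ.IsRegularAt x) (C : α ⊕ β)
    {F : SuperFn α' β'} (hF : ContDiffAt ℝ ∞ F (φ.body x)) :
    SuperFn.partialDeriv C (φ.pullback F) x =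
      ∑ A, SuperFn.partialDeriv C (φ A) x * φ.pullback (SuperFn.partialDeriv A F) x := by
  set N := Fintype.card β with hN
  let V : ℕ → Grassmann β := fun k => ∑ a, SuperFn.partialDeriv C (φ.soulFn a) x *
        taylorTerm φ k (evenPartial a F) x
  -- The bound on degrees alone does not give this, since differentiating a soul can lower its
  -- degree. Instead, the term of order `N + 1` vanishes identically, and its derivative formula
  -- leaves only `N + 1` times `V N`.
  have hVN : V N = 0 := by
    have h0 : taylorTerm φ (N + 1) F = 0 := by
      funext y; exact taylorTerm_eq_zero (Nat.lt_succ_self _) F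
    have h1 := h.partialDeriv_taylorTerm C (N + 1) hF
    rw [h0, partialDeriv_const_zero] at h1
    simp only [taylorTerm_eq_zero (Nat.lt_succ_self N), mul_zero, Finset.sum_const_zero,
      zero_add, Nat.add_sub_cancel] at h1
    exact (smul_eq_zero.1 h1.symm).resolve_left (by positivity)
  have hP : φ.pullback F =
      ∑ k ∈ Finset.range (N + 1), ((k.factorial : ℝ)⁻¹) • taylorTerm φ k F := by
    funext y; simp [pullback, hN]
  have hT := fun k => h.contDiffAt_taylorTerm k hF
  -- Since k/k! = 1/(k-1)!, a shift of index gives the soul derivatives the same weights as the body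
  -- derivatives; the two then add up to the derivative of the even component.
  have hV : ∑ k ∈ Finset.range (N + 1), ((k.factorial : ℝ)⁻¹) • ((k : ℝ) • V (k - 1)) =
      ∑ k ∈ Finset.range (N + 1), ((k.factorial : ℝ)⁻¹) • V k := by
    rw [Finset.sum_range_succ', Finset.sum_range_succ, hVN]
    simp only [CharP.cast_eq_zero, zero_smul, smul_zero, add_zero, Nat.add_sub_cancel]
    refine Finset.sum_congr rfl fun k _ => ?_
    rw [smul_smul]
    congr 1
    rw [Nat.factorial_succ]
    have := Nat.factorial_ne_zero k
    push_cast
    field_simp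
  rw [hP, partialDeriv_sum _ fun k _ => (hT k).differentiableAt_top.const_smul _]
  simp only [partialDeriv_smul _ (hT _).differentiableAt_top, h.partialDeriv_taylorTerm C _ hF,
    smul_add, Finset.sum_add_distrib]
  rw [hV, Fintype.sum_sum_type]
  have hA : ∀ a, SuperFn.partialDeriv C (φ (.inl a)) x =
      SuperFn.partialDeriv C (φ.bodyFn a) x + SuperFn.partialDeriv C (φ.soulFn a) x := by
    intro a
    rw [← partialDeriv_add (h.contDiffAt_bodyFn a).differentiableAt_top
      (h.contDiffAt_soulFn a).differentiableAt_top, bodyFn_add_soulFn]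
  have hinl : ∀ a, SuperFn.partialDeriv (.inl a) F = evenPartial a F := fun _ => rfl
  have hinr : ∀ j, SuperFn.partialDeriv (.inr j) F = oddPartial j F := fun _ => rfl
  simp only [hA, hinl, hinr, add_mul, smul_add, Finset.sum_add_distrib, pullback, V, Finset.mul_sum,
    Finset.smul_sum, mul_smul_comm, ← hN]
  rw [Finset.sum_comm, Finset.sum_comm (s := Finset.range (N + 1)),
    Finset.sum_comm (s := Finset.range (N + 1)), add_right_comm]

end SuperMap

/-! ### Lifting functions and coordinate changes to the cotangent superdomain. -/

namespace Cotangent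

open SuperFn Grassmann

variable {α β : Type}

/-- The inclusion of the Grassmann algebra of the base. -/
def incl : Grassmann β →ₐ[ℝ] Grassmann (β ⊕ β) :=
  ExteriorAlgebra.map
    ((LinearEquiv.sumArrowLequivProdArrow β β ℝ ℝ).symm.toLinearMap ∘ₗ LinearMap.inl ℝ _ _)

/-- The projection of the cotangent superdomain. -/
def proj (z : α ⊕ α → ℝ) : α → ℝ := fun a => z (Sum.inl a)

lemma lift_apply (F : SuperFn α β) (z : α ⊕ α → ℝ) : lift F z = incl (F (proj z)) := rfl

lemma incl_ι (w : β → ℝ) :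
    incl (ExteriorAlgebra.ι ℝ w) = ExteriorAlgebra.ι ℝ (Sum.elim w (0 : β → ℝ)) := by
  rw [incl, ExteriorAlgebra.map_apply_ι]
  congr 1

lemma incl_involute (a : Grassmann β) :
    incl (CliffordAlgebra.involute a) = CliffordAlgebra.involute (incl a) := by
  induction a using ExteriorAlgebra.induction with
  | algebraMap r => simp
  | ι w => rw [CliffordAlgebra.involute_ι, map_neg, incl_ι, CliffordAlgebra.involute_ι]
  | mul a c ha hc => simp only [map_mul, ha, hc]
  | add a c ha hc => simp only [map_add, ha, hc]

lemma incl_parityAut (ε : ZMod 2) (a : Grassmann β) :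
    incl (parityAut ε a) = parityAut ε (incl a) := by
  obtain rfl | rfl := ZMod.two_cases ε
  · simp
  · simpa using incl_involute a

lemma incl_mem {ε : ZMod 2} {a : Grassmann β} (ha : a ∈ ofParity β ε) :
    incl a ∈ ofParity (β ⊕ β) ε := by
  obtain rfl | rfl := ZMod.two_cases ε
  · rw [mem_even_iff, ← incl_involute, mem_even_iff.1 ha]
  · rw [mem_odd_iff, ← incl_involute, mem_odd_iff.1 ha, map_neg]

lemma body_incl (a : Grassmann β) : body (incl a) = body a := by
  simp only [body]
  induction a using ExteriorAlgebra.induction with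
  | algebraMap r => simp
  | ι w => rw [incl_ι]; simp [ExteriorAlgebra.algebraMapInv]
  | mul a c ha hc => simp only [map_mul, ha, hc]
  | add a c ha hc => simp only [map_add, ha, hc]

lemma soul_incl (a : Grassmann β) : soul (incl a) = incl (soul a) := by
  simp only [soul, body_incl, map_sub, AlgHom.commutes]

lemma contractLeft_inl_incl (j : β) (a : Grassmann β) :
    CliffordAlgebra.contractLeft (LinearMap.proj (Sum.inl j) : Module.Dual ℝ (β ⊕ β → ℝ)) (incl a) =
      incl (CliffordAlgebra.contractLeft (LinearMap.proj j : Module.Dual ℝ (β → ℝ)) a) := by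
  induction a using ExteriorAlgebra.induction with
  | algebraMap r => simp [CliffordAlgebra.contractLeft_algebraMap]
  | ι w => rw [incl_ι, CliffordAlgebra.contractLeft_ι, CliffordAlgebra.contractLeft_ι]; simp
  | mul a c ha hc => simp only [map_mul, contractLeft_mul, ha, hc, map_add, incl_involute]
  | add a c ha hc => simp only [map_add, ha, hc]

lemma contractLeft_inr_incl (j : β) (a : Grassmann β) :
    CliffordAlgebra.contractLeft (LinearMap.proj (Sum.inr j) : Module.Dual ℝ (β ⊕ β → ℝ))
      (incl a) = 0 := by
  induction a using ExteriorAlgebra.induction with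
  | algebraMap r => simp [CliffordAlgebra.contractLeft_algebraMap]
  | ι w => rw [incl_ι, CliffordAlgebra.contractLeft_ι]; simp
  | mul a c ha hc => simp only [map_mul, contractLeft_mul, ha, hc, mul_zero, zero_mul, add_zero]
  | add a c ha hc => simp only [map_add, ha, hc, add_zero]

lemma coordParity_pos (A : α ⊕ β) : coordParity (pos A) = coordParity A := by
  cases A <;> rfl

lemma coordParity_mom (A : α ⊕ β) : coordParity (mom A) = coordParity A := by
  cases A <;> rfl

lemma p_mem [DecidableEq β] (A : α ⊕ β) (z : α ⊕ α → ℝ) :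
    p A z ∈ ofParity (β ⊕ β) (coordParity A) := by
  rw [← coordParity_mom]
  exact coord_mem _ z

variable [Fintype α] [DecidableEq α] [Fintype β] {F : SuperFn α β} {z : α ⊕ α → ℝ}

lemma contDiff_proj : ContDiff ℝ ∞ (proj : (α ⊕ α → ℝ) → α → ℝ) :=
  contDiff_pi.2 fun a => contDiff_apply ℝ ℝ (Sum.inl a)

lemma contDiffAt_lift (hF : ContDiffAt ℝ ∞ F (proj z)) : ContDiffAt ℝ ∞ (lift F) z :=
  contDiffAt_linear_comp (F := fun z => F (proj z)) incl.toLinearMap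
    (hF.comp z contDiff_proj.contDiffAt)

lemma isOpen_overDom {U : Set (α → ℝ)} (hU : IsOpen U) : IsOpen (overDom U) :=
  hU.preimage contDiff_proj.continuous

/-- The projection as a continuous linear map. -/
def projL : (α ⊕ α → ℝ) →L[ℝ] (α → ℝ) :=
  ContinuousLinearMap.pi fun a => ContinuousLinearMap.proj (Sum.inl a)

lemma evenPartial_lift (hF : DifferentiableAt ℝ F (proj z)) (a : α ⊕ α) :
    evenPartial a (lift F) z = incl (fderiv ℝ F (proj z) (proj (Pi.single a 1))) := by
  have h : HasFDerivAt (lift F)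
      ((clm incl.toLinearMap).comp ((fderiv ℝ F (proj z)).comp projL)) z :=
    (clm incl.toLinearMap).hasFDerivAt.comp z
      (HasFDerivAt.comp (f := proj) z hF.hasFDerivAt (projL (α := α)).hasFDerivAt)
  rw [evenPartial_apply h.differentiableAt, h.fderiv]
  rfl

lemma partialDeriv_pos_lift (hF : DifferentiableAt ℝ F (proj z)) (A : α ⊕ β) :
    partialDeriv (pos A) (lift F) z = incl (partialDeriv A F (proj z)) := by
  cases A with
  | inl a =>
    refine (evenPartial_lift hF (.inl a)).trans ?_
    simp only [partialDeriv]
    rw [evenPartial_apply hF]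
    congr 2
    funext b
    simp [proj, Pi.single_apply]
  | inr j => exact contractLeft_inl_incl j _

lemma partialDeriv_mom_lift (hF : DifferentiableAt ℝ F (proj z)) (A : α ⊕ β) :
    partialDeriv (mom A) (lift F) z = 0 := by
  cases A with
  | inl a =>
    refine (evenPartial_lift hF (.inr a)).trans ?_
    have : proj (Pi.single (.inr a) 1 : α ⊕ α → ℝ) = 0 := by
      funext b; simp [proj]
    rw [this, map_zero, map_zero]
  | inr j => exact contractLeft_inr_incl j _

section pullback

variable {φ : SuperMap α β α β} {Φ : SuperMap (α ⊕ α) (β ⊕ β) (α ⊕ α) (β ⊕ β)}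

lemma proj_body (hΦ : ∀ A, Φ (pos A) = lift (φ A)) (z : α ⊕ α → ℝ) :
    proj (Φ.body z) = φ.body (proj z) := by
  funext a
  have h : Φ (.inl (.inl a)) = lift (φ (.inl a)) := hΦ (.inl a)
  simp only [proj, SuperMap.body]
  rw [h, lift_apply, body_incl]

/-- A lifted function does not depend on the momenta, so only the souls of the position components
enter, and these are lifted from the base. -/
lemma taylorTerm_lift (hΦ : ∀ A, Φ (pos A) = lift (φ A))
    (hφ1 : ∀ j, φ (.inr j) (proj z) ∈ ofParity β 1)
    (hΦ1 : ∀ j, Φ (.inr j) z ∈ ofParity (β ⊕ β) 1) (k : ℕ)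
    (hF : ContDiffAt ℝ ∞ F (φ.body (proj z))) :
    SuperMap.taylorTerm Φ k (lift F) z = incl (SuperMap.taylorTerm φ k F (proj z)) := by
  induction k generalizing F with
  | zero =>
    simp only [SuperMap.taylorTerm]
    rw [lift_apply, proj_body hΦ]
    induction F (φ.body (proj z)) using ExteriorAlgebra.induction with
    | algebraMap r => simp
    | ι w =>
      have h : ∀ j, Φ (.inr (.inl j)) = lift (φ (.inr j)) := fun j => hΦ (.inr j)
      rw [incl_ι, subst_ι hΦ1, subst_ι hφ1, Fintype.sum_sum_type]
      simp [h, lift_apply]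
    | mul a c ha hc => simp only [map_mul, ha, hc]
    | add a c ha hc => simp only [map_add, ha, hc]
  | succ k ih =>
    simp only [SuperMap.taylorTerm]
    have hd : ∀ᶠ y in 𝓝 (Φ.body z), DifferentiableAt ℝ F (proj y) := by
      rw [← proj_body hΦ] at hF
      exact contDiff_proj.continuous.continuousAt.eventually hF.eventually_differentiableAt
    rw [Fintype.sum_sum_type, map_sum]
    have h0 : ∀ a, SuperMap.taylorTerm Φ k (evenPartial (.inr a) (lift F)) z = 0 := by
      intro a
      rw [SuperMap.taylorTerm_congr k (G := 0), SuperMap.taylorTerm_zero]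
      exact hd.mono fun y hy => partialDeriv_mom_lift hy (.inl a)
    have h1 : ∀ a, SuperMap.taylorTerm Φ k (evenPartial (.inl a) (lift F)) z =
        incl (SuperMap.taylorTerm φ k (evenPartial a F) (proj z)) := by
      intro a
      rw [← ih (contDiffAt_evenPartial hF a)]
      refine SuperMap.taylorTerm_congr k ?_
      exact hd.mono fun y hy => partialDeriv_pos_lift hy (.inl a)
    have h2 : ∀ a, Φ (.inl (.inl a)) = lift (φ (.inl a)) := fun a => hΦ (.inl a)
    simp only [h0, h1, h2, lift_apply, zero_mul, Finset.sum_const_zero, add_zero, map_mul,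
      soul_incl]

/-- The pullback of a function on the base along a map that covers `φ`. -/
lemma pullback_lift (hΦ : ∀ A, Φ (pos A) = lift (φ A))
    (hφ1 : ∀ j, φ (.inr j) (proj z) ∈ ofParity β 1)
    (hΦ1 : ∀ j, Φ (.inr j) z ∈ ofParity (β ⊕ β) 1)
    (hF : ContDiffAt ℝ ∞ F (φ.body (proj z))) :
    Φ.pullback (lift F) z = incl (φ.pullback F (proj z)) := by
  simp only [SuperMap.pullback, taylorTerm_lift hΦ hφ1 hΦ1 _ hF, map_sum, map_smul]
  symm
  -- The cotangent superdomain has twice as many odd coordinates, so its Taylor sum is longer; the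
  -- additional terms already vanish on the base.
  refine Finset.sum_subset ?_ fun k _ hk => ?_
  · intro k
    simp only [Finset.mem_range, Fintype.card_sum]
    omega
  · rw [SuperMap.taylorTerm_eq_zero (by simpa using hk), map_zero, smul_zero]

end pullback

section liftMap

variable [DecidableEq β] {φ ψ : SuperMap α β α β}

lemma liftMap_pos (A : α ⊕ β) : liftMap φ ψ (pos A) = lift (φ A) := by
  cases A <;> rfl

lemma liftMap_mom (A : α ⊕ β) :
    liftMap φ ψ (mom A) = ∑ B, lift (φ.pullback (partialDeriv A (ψ B))) * p B := by
  cases A <;> rfl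

lemma exists_pos_or_mom (C : (α ⊕ α) ⊕ (β ⊕ β)) : ∃ A : α ⊕ β, C = pos A ∨ C = mom A := by
  rcases C with (a | a) | (j | j)
  exacts [⟨.inl a, .inl rfl⟩, ⟨.inl a, .inr rfl⟩, ⟨.inr j, .inl rfl⟩, ⟨.inr j, .inr rfl⟩]

/-- In the momentum components, a Jacobian entry has the sum of the parities of `A` and `B`, and the
factor `p B` cancels that of `B`. -/
lemma liftMap_mem {V : Set (α → ℝ)} (hV : IsOpen V)
    (hφ : ∀ A, φ A (proj z) ∈ ofParity β (coordParity A))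
    (hx : φ.body (proj z) ∈ V) (hψ : ∀ A, (ψ A).SmoothOn V)
    (hψ' : ∀ A, (ψ A).HasParityOn (coordParity A) V) (C : (α ⊕ α) ⊕ (β ⊕ β)) :
    liftMap φ ψ C z ∈ ofParity (β ⊕ β) (coordParity C) := by
  obtain ⟨A, rfl | rfl⟩ := exists_pos_or_mom C
  · rw [liftMap_pos, coordParity_pos]
    exact incl_mem (hφ A)
  · rw [liftMap_mom, coordParity_mom, Finset.sum_apply]
    refine Submodule.sum_mem _ fun B _ => ?_
    have h := mul_mem (incl_mem (SuperMap.pullback_mem hV ((hψ B).partialDeriv hV A)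
      ((hψ' B).partialDeriv hV (hψ B) A) hx hφ)) (p_mem B z)
    have h2 : coordParity B + coordParity A + coordParity B = coordParity A := by
      rw [add_right_comm, CharTwo.add_self_eq_zero, zero_add]
    rwa [h2] at h

end liftMap

end Cotangent

/-! ### Global functions on the cotangent bundle and symbols. -/

namespace Supermanifold

open SuperFn Grassmann Cotangent

variable {n m : ℕ} {M : Supermanifold.{u, v} n m}

lemma isOpen_dom (i : M.Index) : IsOpen (M.dom i) := (M.chart i).open_target

lemma isOpen_overlap (i j : M.Index) : IsOpen (M.overlap i j) :=
  ((M.chart i).symm.trans (M.chart j)).open_source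

lemma mem_overlap {i j : M.Index} {x : Fin n → ℝ} :
    x ∈ M.overlap i j ↔ x ∈ M.dom i ∧ (M.chart i).symm x ∈ (M.chart j).source := by
  simp [overlap, dom]

lemma body_mem_overlap {i j : M.Index} {x : Fin n → ℝ} (hx : x ∈ M.overlap i j) :
    (M.trans i j).body x ∈ M.overlap j i := by
  rw [M.trans_body i j x hx, mem_overlap]
  rw [mem_overlap] at hx
  refine ⟨(M.chart j).map_source hx.2, ?_⟩
  rw [(M.chart j).left_inv hx.2]
  exact (M.chart i).map_target hx.1

lemma overlap_subset_dom (i j : M.Index) : M.overlap i j ⊆ M.dom i :=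
  fun _ hx => (mem_overlap.1 hx).1

lemma isRegularAt_trans {i j : M.Index} {x : Fin n → ℝ} (hx : x ∈ M.overlap i j) :
    (M.trans i j).IsRegularAt x where
  smooth A := (M.trans_smooth i j A).contDiffAt (isOpen_overlap i j) hx
  parity A := ((isOpen_overlap i j).eventually_mem hx).mono (M.trans_parity i j A)

/-- The Jacobian matrices of mutually inverse changes of coordinates are mutually inverse. -/
lemma jacobian {i j : M.Index} {x : Fin n → ℝ} (hx : x ∈ M.overlap i j)
    (C B : Fin n ⊕ Fin m) :
    ∑ A, partialDeriv C (M.trans i j A) x *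
      (M.trans i j).pullback (partialDeriv A (M.trans j i B)) x = if C = B then 1 else 0 := by
  rw [← (isRegularAt_trans hx).partialDeriv_pullback C
    ((M.trans_smooth j i B).contDiffAt (isOpen_overlap j i) (body_mem_overlap hx)),
    ← partialDeriv_coord C B x]
  refine partialDeriv_congr ?_ C
  -- Near `x` the cocycle condition for `i`, `j`, `i` identifies the composite with `trans i i`,
  -- hence with the coordinate functions.
  filter_upwards [(isOpen_overlap i j).mem_nhds hx] with y hy
  have hy' := mem_overlap.1 hy
  refine (M.trans_cocycle i j i B ⟨hy, mem_overlap.2 ⟨hy'.1, ?_⟩⟩).trans (M.trans_self i B hy'.1)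
  exact (M.chart i).map_target hy'.1

lemma liftMap_trans_mem {i j : M.Index} {z : Fin n ⊕ Fin n → ℝ}
    (hz : z ∈ overDom (M.overlap i j)) (C : (Fin n ⊕ Fin n) ⊕ (Fin m ⊕ Fin m)) :
    liftMap (M.trans i j) (M.trans j i) C z ∈ ofParity (Fin m ⊕ Fin m) (coordParity C) :=
  liftMap_mem (isOpen_overlap j i) (fun A => M.trans_parity i j A _ hz) (body_mem_overlap hz)
    (M.trans_smooth j i) (M.trans_parity j i) C

lemma liftMap_trans_body_mem {i j : M.Index} {z : Fin n ⊕ Fin n → ℝ}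
    (hz : z ∈ overDom (M.overlap i j)) :
    (liftMap (M.trans i j) (M.trans j i)).body z ∈ overDom (M.dom j) := by
  have h : proj ((liftMap (M.trans i j) (M.trans j i)).body z) ∈ M.dom j := by
    rw [proj_body liftMap_pos]
    exact overlap_subset_dom j i (body_mem_overlap hz)
  exact h

lemma IsCotangentFn.contDiffAt {F : M.CotangentFamily} (hF : M.IsCotangentFn F) {i : M.Index}
    {z : Fin n ⊕ Fin n → ℝ} (hz : z ∈ overDom (M.dom i)) : ContDiffAt ℝ ∞ (F i) z :=
  (hF.smooth i).contDiffAt (isOpen_overDom (isOpen_dom i)) hz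

lemma IsCotangentFn.add {F G : M.CotangentFamily} (hF : M.IsCotangentFn F)
    (hG : M.IsCotangentFn G) : M.IsCotangentFn (F + G) where
  smooth i := smoothOn_iff.2 fun _ hz =>
    ((hF.contDiffAt hz).add (hG.contDiffAt hz)).contDiffWithinAt
  compat i j z hz := by
    have hb := liftMap_trans_body_mem hz
    rw [Pi.add_apply, SuperMap.pullback_add (hF.contDiffAt hb) (hG.contDiffAt hb),
      hF.compat i j hz, hG.compat i j hz]
    rfl

lemma IsCotangentFn.mul {F G : M.CotangentFamily} (hF : M.IsCotangentFn F)
    (hG : M.IsCotangentFn G) : M.IsCotangentFn (F * G) where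
  smooth i := smoothOn_iff.2 fun _ hz =>
    (contDiffAt_mul (hF.contDiffAt hz) (hG.contDiffAt hz)).contDiffWithinAt
  compat i j z hz := by
    have hb := liftMap_trans_body_mem hz
    rw [Pi.mul_apply, SuperMap.pullback_mul (hF.contDiffAt hb) (hG.contDiffAt hb)
      fun a => liftMap_trans_mem hz (.inl a), hF.compat i j hz, hG.compat i j hz]
    rfl

lemma VectorField.contDiffAt_comp (X : M.VectorField) {i : M.Index} (A : Fin n ⊕ Fin m)
    {x : Fin n → ℝ} (hx : x ∈ M.dom i) : ContDiffAt ℝ ∞ (X.comp i A) x :=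
  (X.smooth i A).contDiffAt (isOpen_dom i) hx

lemma contDiffAt_p (A : Fin n ⊕ Fin m) (z : Fin n ⊕ Fin n → ℝ) :
    ContDiffAt ℝ ∞ (p A : SuperFn (Fin n ⊕ Fin n) (Fin m ⊕ Fin m)) z :=
  (contDiff_coord (mom A)).contDiffAt

lemma VectorField.contDiffAt_lift_mul_p (X : M.VectorField) {i : M.Index} (A : Fin n ⊕ Fin m)
    {z : Fin n ⊕ Fin n → ℝ} (hz : z ∈ overDom (M.dom i)) :
    ContDiffAt ℝ ∞ (lift (X.comp i A) * p A) z :=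
  contDiffAt_mul (contDiffAt_lift (X.contDiffAt_comp A hz)) (contDiffAt_p A z)

/-- The symbol of a vector field is a function on the cotangent bundle. -/
lemma VectorField.isCotangentFn_symbol (X : M.VectorField) : M.IsCotangentFn X.symbol where
  smooth i := smoothOn_iff.2 fun z hz =>
    (contDiffAt_sum _ fun A _ => X.contDiffAt_lift_mul_p A hz).contDiffWithinAt
  compat i j z hz := by
    have hb := liftMap_trans_body_mem hz
    have hx : proj z ∈ M.overlap i j := hz
    have hodd := fun a => liftMap_trans_mem hz (.inr a)
    -- The laws for components and momenta place a Jacobian next to its inverse; summing over `A`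
    -- later leaves a Kronecker delta.
    have hA : ∀ A, (liftMap (M.trans i j) (M.trans j i)).pullback (lift (X.comp j A) * p A) z =
        ∑ B, ∑ C, incl (X.comp i C (proj z) * (partialDeriv C (M.trans i j A) (proj z) *
          (M.trans i j).pullback (partialDeriv A (M.trans j i B)) (proj z))) * p B z := by
      intro A
      have hc : ContDiffAt ℝ ∞ (X.comp j A) ((M.trans i j).body (proj z)) :=
        X.contDiffAt_comp A (overlap_subset_dom j i (body_mem_overlap hx))
      rw [SuperMap.pullback_mul _ (contDiffAt_p A _) fun a => liftMap_trans_mem hz (.inl a),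
        pullback_lift liftMap_pos (fun k => M.trans_parity i j (.inr k) _ hx) hodd hc, p,
        SuperMap.pullback_coord hodd, X.compat i j A hx, liftMap_mom, Finset.sum_apply,
        Finset.sum_apply, Finset.mul_sum]
      · refine Finset.sum_congr rfl fun B _ => ?_
        rw [map_sum, Finset.sum_mul]
        refine Finset.sum_congr rfl fun C _ => ?_
        rw [Pi.mul_apply, Pi.mul_apply, lift_apply, ← mul_assoc, ← map_mul, mul_assoc]
      · exact contDiffAt_lift (X.contDiffAt_comp A hb)
    simp only [symbol]
    rw [SuperMap.pullback_sum _ fun A _ => X.contDiffAt_lift_mul_p A hb]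
    simp only [hA]
    rw [Finset.sum_comm, Finset.sum_apply]
    refine Finset.sum_congr rfl fun B _ => ?_
    rw [Finset.sum_comm]
    simp only [← Finset.sum_mul, ← map_sum, ← Finset.mul_sum, jacobian hx]
    simp [lift_apply]

lemma VectorField.symbol_parity {X : M.VectorField} {ε : ZMod 2} (hX : X.HasParity ε) :
    M.CotangentHasParity X.symbol ε := by
  intro i z hz
  rw [symbol, Finset.sum_apply]
  refine Submodule.sum_mem _ fun A _ => ?_
  have h := Grassmann.mul_mem (incl_mem (hX i A _ hz)) (p_mem A z)
  rwa [add_assoc, CharTwo.add_self_eq_zero, add_zero] at h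

lemma IsFibreQuadratic.add {F G : M.CotangentFamily} (hF : M.IsFibreQuadratic F)
    (hG : M.IsFibreQuadratic G) : M.IsFibreQuadratic (F + G) := by
  intro i
  obtain ⟨c, hc, hFc⟩ := hF i
  obtain ⟨d, hd, hGd⟩ := hG i
  refine ⟨fun A B => c A B + d A B, fun A B => smoothOn_iff.2 <|
    (smoothOn_iff.1 (hc A B)).add (smoothOn_iff.1 (hd A B)), fun z hz => ?_⟩
  rw [Pi.add_apply, Pi.add_apply, hFc hz, hGd hz]
  simp only [Finset.sum_apply, Pi.mul_apply, lift_apply, Pi.add_apply, map_add, add_mul,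
    Finset.sum_add_distrib]

lemma VectorField.isFibreQuadratic_symbol_mul (X Y : M.VectorField) :
    M.IsFibreQuadratic (X.symbol * Y.symbol) := by
  intro i
  -- The involution on the second coefficient is the sign from moving `p A` to the right past it.
  refine ⟨fun A B => X.comp i A * fun x => parityAut (coordParity A) (Y.comp i B x), fun A B =>
    smoothOn_iff.2 fun x hx => ?_, fun z hz => ?_⟩
  · exact (contDiffAt_mul (X.contDiffAt_comp A hx) (contDiffAt_linear_comp
      (parityAut (coordParity A)).toLinearMap (Y.contDiffAt_comp B hx))).contDiffWithinAt
  · simp only [symbol, Pi.mul_apply, Finset.sum_apply, Finset.sum_mul_sum, lift_apply]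
    refine Finset.sum_congr rfl fun A _ => Finset.sum_congr rfl fun B _ => ?_
    have h := parityAut_mul_comm (ε := coordParity A) (δ := 0)
      (incl (Y.comp i B (proj z))) (h := p A z) (by simpa using p_mem A z)
    rw [parityAut_zero] at h
    rw [map_mul, incl_parityAut, mul_assoc, mul_assoc, mul_assoc, ← mul_assoc (p A z), ← h,
      mul_assoc]

end Supermanifold

/-! ### Signs, and the algebraic rules of the Poisson bracket. -/

namespace Grassmann

variable {β : Type} {ε δ : ZMod 2} {a b : Grassmann β}

lemma parityAut_of_mem (ha : a ∈ ofParity β ε) :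
    parityAut δ a = ((-1 : ℝ) ^ (δ * ε).val) • a := by
  obtain rfl | rfl := ZMod.two_cases ε <;> obtain rfl | rfl := ZMod.two_cases δ
  · simp
  · simp [mem_even_iff.1 ha]
  · simp
  · simp [mem_odd_iff.1 ha, ZMod.val_one]

lemma mul_comm_sign (ha : a ∈ ofParity β ε) (hb : b ∈ ofParity β δ) :
    b * a = ((-1 : ℝ) ^ (ε * δ).val) • (a * b) := by
  rw [mul_comm_of_mem ha, parityAut_of_mem hb, mul_smul_comm]

end Grassmann

namespace Cotangent

open SuperFn Grassmann

variable {α β : Type} [Fintype α] [DecidableEq α] [Fintype β]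
  {F G H : SuperFn (α ⊕ α) (β ⊕ β)} {z : α ⊕ α → ℝ} {f g : ZMod 2}

/-- `F` is smooth at `z` and of parity `f` near `z`. -/
structure IsHomogeneousAt (F : SuperFn (α ⊕ α) (β ⊕ β)) (f : ZMod 2) (z : α ⊕ α → ℝ) : Prop where
  smooth : ContDiffAt ℝ ∞ F z
  parity : ∀ᶠ y in 𝓝 z, F y ∈ ofParity (β ⊕ β) f

lemma IsHomogeneousAt.mem (hF : IsHomogeneousAt F f z) : F z ∈ ofParity (β ⊕ β) f :=
  hF.parity.self_of_nhds

lemma IsHomogeneousAt.add (hF : IsHomogeneousAt F f z) (hG : IsHomogeneousAt G f z) :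
    IsHomogeneousAt (F + G) f z where
  smooth := hF.smooth.add hG.smooth
  parity := (hF.parity.and hG.parity).mono fun _ hy => add_mem hy.1 hy.2

lemma IsHomogeneousAt.mul (hF : IsHomogeneousAt F f z) (hG : IsHomogeneousAt G g z) :
    IsHomogeneousAt (F * G) (f + g) z where
  smooth := contDiffAt_mul hF.smooth hG.smooth
  parity := (hF.parity.and hG.parity).mono fun _ hy => mul_mem hy.1 hy.2

lemma IsHomogeneousAt.partialDeriv_pos_mem (hF : IsHomogeneousAt F f z) (A : α ⊕ β) :
    partialDeriv (pos A) F z ∈ ofParity (β ⊕ β) (f + coordParity A) := by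
  rw [← coordParity_pos]
  exact partialDeriv_mem hF.parity hF.smooth.differentiableAt_top _

lemma IsHomogeneousAt.partialDeriv_mom_mem (hF : IsHomogeneousAt F f z) (A : α ⊕ β) :
    partialDeriv (mom A) F z ∈ ofParity (β ⊕ β) (f + coordParity A) := by
  rw [← coordParity_mom]
  exact partialDeriv_mem hF.parity hF.smooth.differentiableAt_top _

/-- Near `z` the twist of a homogeneous function is a constant sign, so the bracket takes the
classical form with explicit signs. -/
lemma IsHomogeneousAt.partialDeriv_twist (hF : IsHomogeneousAt F f z) (A : α ⊕ β)
    (B : (α ⊕ α) ⊕ (β ⊕ β)) :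
    partialDeriv B (twist A F) z =
      ((-1 : ℝ) ^ (coordParity A * f).val) • partialDeriv B F z := by
  rw [← partialDeriv_smul _ hF.smooth.differentiableAt_top]
  refine partialDeriv_congr ?_ B
  filter_upwards [hF.parity] with y hy
  cases A with
  | inl a => simp [coordParity, twist]
  | inr j => simpa [coordParity, twist] using parityAut_of_mem (δ := 1) hy

lemma IsHomogeneousAt.bracket_apply (hF : IsHomogeneousAt F f z) :
    bracket F G z = ∑ A : α ⊕ β, ((-1 : ℝ) ^ (coordParity A * f).val) •
      (((-1 : ℝ) ^ (coordParity A).val) • (partialDeriv (mom A) F z * partialDeriv (pos A) G z)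
        - partialDeriv (pos A) F z * partialDeriv (mom A) G z) := by
  rw [bracket, Finset.sum_apply]
  refine Finset.sum_congr rfl fun A _ => ?_
  rw [Pi.sub_apply, Pi.smul_apply, Pi.mul_apply, Pi.mul_apply, hF.partialDeriv_twist,
    hF.partialDeriv_twist, smul_sub, smul_mul_assoc, smul_mul_assoc, smul_comm]

lemma bracket_add (hG : DifferentiableAt ℝ G z) (hH : DifferentiableAt ℝ H z) :
    bracket F (G + H) z = bracket F G z + bracket F H z := by
  simp only [bracket, Finset.sum_apply, Pi.sub_apply, Pi.smul_apply, Pi.mul_apply]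
  rw [← Finset.sum_add_distrib]
  refine Finset.sum_congr rfl fun A _ => ?_
  rw [partialDeriv_add hG hH, partialDeriv_add hG hH, mul_add, mul_add, smul_add]
  abel

/-- The Leibniz rule for the Poisson bracket. -/
lemma IsHomogeneousAt.bracket_mul (hF : IsHomogeneousAt F f z) (hG : DifferentiableAt ℝ G z)
    (hH : DifferentiableAt ℝ H z) :
    bracket F (G * H) z = bracket F G z * H z + parityAut f (G z) * bracket F H z := by
  simp only [hF.bracket_apply]
  rw [Finset.sum_mul, Finset.mul_sum, ← Finset.sum_add_distrib]
  refine Finset.sum_congr rfl fun A _ => ?_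
  -- The sign of the derivative along `A` and the move past the derivative of `F` combine into a
  -- sign depending only on the parity of `F`, the same for every `A`.
  have h1 := parityAut_mul_comm (G z) (hF.partialDeriv_pos_mem A)
  have h2 := parityAut_mul_comm (G z) (hF.partialDeriv_mom_mem A)
  rw [partialDeriv_mul hG hH, partialDeriv_mul hG hH, coordParity_pos, coordParity_mom, mul_add,
    mul_add, ← mul_assoc _ (parityAut _ _), ← mul_assoc _ (parityAut _ _), ← h1, ← h2]
  simp only [smul_mul_assoc, mul_smul_comm, sub_mul, mul_sub, smul_sub, smul_add, mul_assoc]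
  abel

/-- The graded antisymmetry of the Poisson bracket. -/
lemma IsHomogeneousAt.bracket_swap (hF : IsHomogeneousAt F f z) (hG : IsHomogeneousAt G g z) :
    bracket G F z = -(((-1 : ℝ) ^ (f * g).val) • bracket F G z) := by
  rw [hF.bracket_apply, hG.bracket_apply, Finset.smul_sum, ← Finset.sum_neg_distrib]
  refine Finset.sum_congr rfl fun A _ => ?_
  rw [mul_comm_sign (hF.partialDeriv_pos_mem A) (hG.partialDeriv_mom_mem A),
    mul_comm_sign (hF.partialDeriv_mom_mem A) (hG.partialDeriv_pos_mem A)]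
  -- Only three parities matter now, and the signs are compared in all eight cases.
  generalize coordParity A = c
  obtain rfl | rfl := ZMod.two_cases c <;> obtain rfl | rfl := ZMod.two_cases f <;>
    obtain rfl | rfl := ZMod.two_cases g <;>
    simp [show (1 + 1 : ZMod 2) = 0 from rfl, ZMod.val_one] <;> abel

end Cotangent

/-! ### Poisson brackets of symbols. -/

namespace Supermanifold

open SuperFn Grassmann Cotangent

variable {n m : ℕ} {M : Supermanifold.{u, v} n m} {X Y : M.VectorField} {ξ η : ZMod 2}
  {i : M.Index} {z : Fin n ⊕ Fin n → ℝ}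

namespace VectorField

/-- Evaluating operator identities on coordinate functions turns them into identities for
components. -/
lemma act_coord (X : M.VectorField) (i : M.Index) (B : Fin n ⊕ Fin m) :
    X.act i (coord B) = X.comp i B := by
  funext x
  simp [act, Finset.sum_apply, partialDeriv_coord]

lemma isHomogeneousAt_symbol (hX : X.HasParity ξ) (hz : z ∈ overDom (M.dom i)) :
    IsHomogeneousAt (X.symbol i) ξ z where
  smooth := X.isCotangentFn_symbol.contDiffAt hz
  parity := ((isOpen_overDom (isOpen_dom i)).eventually_mem hz).mono (symbol_parity hX i)

lemma partialDeriv_pos_symbol (X : M.VectorField) (hz : z ∈ overDom (M.dom i))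
    (A : Fin n ⊕ Fin m) :
    partialDeriv (pos A) (X.symbol i) z =
      ∑ B, incl (partialDeriv A (X.comp i B) (proj z)) * p B z := by
  rw [symbol, partialDeriv_sum _ fun B _ => (X.contDiffAt_lift_mul_p B hz).differentiableAt_top]
  refine Finset.sum_congr rfl fun B _ => ?_
  have hd : ContDiffAt ℝ ∞ (X.comp i B) (proj z) := X.contDiffAt_comp B hz
  rw [partialDeriv_mul (contDiffAt_lift hd).differentiableAt_top
    (contDiffAt_p B z).differentiableAt_top, partialDeriv_pos_lift hd.differentiableAt_top, p,
    partialDeriv_coord, if_neg, mul_zero, add_zero]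
  cases A <;> cases B <;> simp [pos, mom]

lemma partialDeriv_mom_symbol (X : M.VectorField) (hz : z ∈ overDom (M.dom i))
    (A : Fin n ⊕ Fin m) :
    partialDeriv (mom A) (X.symbol i) z =
      parityAut (coordParity A) (incl (X.comp i A (proj z))) := by
  rw [symbol, partialDeriv_sum _ fun B _ => (X.contDiffAt_lift_mul_p B hz).differentiableAt_top]
  have hB : ∀ B, partialDeriv (mom A) (lift (X.comp i B) * p B) z =
      if A = B then parityAut (coordParity A) (incl (X.comp i B (proj z))) else 0 := by
    intro B
    have hd : ContDiffAt ℝ ∞ (X.comp i B) (proj z) := X.contDiffAt_comp B hz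
    have hinj : (mom A : (Fin n ⊕ Fin n) ⊕ (Fin m ⊕ Fin m)) = mom B ↔ A = B := by
      cases A <;> cases B <;> simp [mom]
    rw [partialDeriv_mul (contDiffAt_lift hd).differentiableAt_top
      (contDiffAt_p B z).differentiableAt_top, partialDeriv_mom_lift hd.differentiableAt_top, p,
      partialDeriv_coord, coordParity_mom, zero_mul, zero_add, mul_ite, mul_one, mul_zero,
      lift_apply]
    simp only [hinj]
  simp [hB]

/-- The Poisson bracket of symbols is the symbol of the commutator. -/
lemma bracket_symbol (hX : X.HasParity ξ) (hY : Y.HasParity η) (hz : z ∈ overDom (M.dom i)) :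
    bracket X.symbol Y.symbol i z =
      ∑ B, incl (X.act i (Y.comp i B) (proj z) -
        ((-1 : ℝ) ^ (ξ * η).val) • Y.act i (X.comp i B) (proj z)) * p B z := by
  have h1 : ∀ A B, ((-1 : ℝ) ^ (coordParity A * ξ).val) • ((-1 : ℝ) ^ (coordParity A).val) •
      (parityAut (coordParity A) (incl (X.comp i A (proj z))) *
        (incl (partialDeriv A (Y.comp i B) (proj z)) * p B z)) =
      incl (X.comp i A (proj z) * partialDeriv A (Y.comp i B) (proj z)) * p B z := by
    intro A B
    rw [parityAut_of_mem (incl_mem (hX i A (proj z) hz)), map_mul, mul_assoc, smul_mul_assoc]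
    generalize coordParity A = c
    obtain rfl | rfl := ZMod.two_cases c <;> obtain rfl | rfl := ZMod.two_cases ξ <;>
      simp [show (1 + 1 : ZMod 2) = 0 from rfl, ZMod.val_one]
  have h2 : ∀ A B, ((-1 : ℝ) ^ (coordParity A * ξ).val) •
      (incl (partialDeriv A (X.comp i B) (proj z)) * p B z *
        parityAut (coordParity A) (incl (Y.comp i A (proj z)))) =
      ((-1 : ℝ) ^ (ξ * η).val) •
        (incl (Y.comp i A (proj z) * partialDeriv A (X.comp i B) (proj z)) * p B z) := by
    intro A B
    -- The parity of `B` cancels between coefficient and momentum, so the sign of the move past the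
    -- component of `Y` does not depend on `B`.
    have hm := Grassmann.mul_mem (incl_mem ((hX i B).partialDeriv (isOpen_dom i)
      (X.smooth i B) A (proj z) hz)) (p_mem B z)
    have he : ξ + coordParity B + coordParity A + coordParity B = ξ + coordParity A := by
      rw [add_right_comm, add_assoc ξ, CharTwo.add_self_eq_zero, add_zero]
    rw [he] at hm
    rw [← parityAut_mul_comm _ hm, parityAut_of_mem (incl_mem (hY i A (proj z) hz)), map_mul,
      mul_assoc, smul_mul_assoc]
    generalize coordParity A = c
    obtain rfl | rfl := ZMod.two_cases c <;> obtain rfl | rfl := ZMod.two_cases ξ <;>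
      obtain rfl | rfl := ZMod.two_cases η <;>
      simp [show (1 + 1 : ZMod 2) = 0 from rfl, ZMod.val_one]
  rw [bracket, (isHomogeneousAt_symbol hX hz).bracket_apply]
  simp only [X.partialDeriv_pos_symbol hz, Y.partialDeriv_pos_symbol hz,
    X.partialDeriv_mom_symbol hz, Y.partialDeriv_mom_symbol hz, smul_sub, Finset.mul_sum,
    Finset.sum_mul, Finset.smul_sum, h1, h2, Finset.sum_sub_distrib]
  rw [Finset.sum_comm, Finset.sum_comm (f := fun A B => ((-1 : ℝ) ^ (ξ * η).val) • _),
    ← Finset.sum_sub_distrib]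
  refine Finset.sum_congr rfl fun B _ => ?_
  simp only [act, Finset.sum_apply, Pi.mul_apply, map_sub, map_smul, map_sum, sub_mul,
    smul_mul_assoc, Finset.sum_mul, Finset.smul_sum]

lemma smoothOn_coord (B : Fin n ⊕ Fin m) (U : Set (Fin n → ℝ)) :
    (coord B : SuperFn (Fin n) (Fin m)).SmoothOn U :=
  smoothOn_iff.2 (contDiff_coord B).contDiffOn

/-- For an odd field the supercommutator with itself is twice its square; on coordinates both terms
vanish. -/
lemma IsHomological.bracket_symbol (hX : X.HasParity 1) (h : X.IsHomological)
    (hz : z ∈ overDom (M.dom i)) : bracket X.symbol X.symbol i z = 0 := by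
  rw [VectorField.bracket_symbol hX hX hz]
  refine Finset.sum_eq_zero fun B _ => ?_
  have h0 := h i (coord B) (smoothOn_coord B _) hz
  rw [act_coord, Pi.zero_apply] at h0
  change X.act i (X.comp i B) (proj z) = 0 at h0
  rw [h0, smul_zero, sub_zero, map_zero, zero_mul]

lemma IsHomothetyOf.bracket_symbol (hX : X.HasParity 0) (hY : Y.HasParity η)
    (h : X.IsHomothetyOf Y) (hz : z ∈ overDom (M.dom i)) :
    bracket X.symbol Y.symbol i z = -Y.symbol i z := by
  rw [VectorField.bracket_symbol hX hY hz, symbol, Finset.sum_apply, ← Finset.sum_neg_distrib]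
  refine Finset.sum_congr rfl fun B _ => ?_
  have h0 := h i (coord B) (smoothOn_coord B _) hz
  rw [act_coord, act_coord] at h0
  change X.act i (Y.comp i B) (proj z) - Y.act i (X.comp i B) (proj z) =
    -Y.comp i B (proj z) at h0
  rw [zero_mul, ZMod.val_zero, pow_zero, one_smul, h0, map_neg, neg_mul]
  rfl

end VectorField

end Supermanifold

end

/-! ### The odd Jacobi structure. -/

open Supermanifold Cotangent Grassmann SuperFn in
theorem mainTheorem1 {n m : ℕ} (M : Supermanifold.{u, v} n m)
    (Q : M.VectorField) (S : M.CotangentFamily) (E : M.VectorField)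
    (h : M.IsExactQS Q S E) :
    M.IsOddJacobi (S + E.symbol * Q.symbol) Q := by
  have hQ := h.isQS.odd_Q
  have hE := h.even_E
  have key : ∀ i, ∀ z ∈ overDom (M.dom i),
      IsHomogeneousAt (S i) 1 z ∧ IsHomogeneousAt (E.symbol i * Q.symbol i) 1 z ∧
      Cotangent.bracket (Q.symbol i) (E.symbol i * Q.symbol i) z = 0 := by
    intro i z hz
    have hs : IsHomogeneousAt (S i) 1 z := ⟨h.isQS.isFn.contDiffAt hz,
      ((isOpen_overDom (isOpen_dom i)).eventually_mem hz).mono (h.isQS.odd i)⟩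
    have he := VectorField.isHomogeneousAt_symbol hE hz
    have hq := VectorField.isHomogeneousAt_symbol hQ hz
    refine ⟨hs, by simpa using he.mul hq, ?_⟩
    have hEQ : Cotangent.bracket (E.symbol i) (Q.symbol i) z = _ :=
      h.homothety_Q.bracket_symbol hE hQ hz
    have hQQ : Cotangent.bracket (Q.symbol i) (Q.symbol i) z = 0 :=
      h.isQS.homological.bracket_symbol hQ hz
    -- {Q,EQ} = {Q,E}Q + E{Q,Q}, where {Q,E} = -{E,Q} = Q, so only the square of the odd symbol
    -- remains.
    rw [hq.bracket_mul he.smooth.differentiableAt_top hq.smooth.differentiableAt_top, hQQ,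
      he.bracket_swap hq, hEQ]
    simp [odd_mul_self hq.mem]
  refine ⟨h.isQS.isFn.add (E.isCotangentFn_symbol.mul Q.isCotangentFn_symbol), fun i z hz => ?_,
    h.isQS.quadratic.add (E.isFibreQuadratic_symbol_mul Q), hQ, h.isQS.homological,
    fun i z hz => ?_, fun i z hz => ?_⟩
  · obtain ⟨hs, heq, -⟩ := key i z hz
    exact (hs.add heq).mem
  · obtain ⟨hs, heq, h0⟩ := key i z hz
    have hQS : Cotangent.bracket (Q.symbol i) (S i) z = 0 := h.isQS.invariance i hz
    change Cotangent.bracket (Q.symbol i) (S i + E.symbol i * Q.symbol i) z = 0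
    rw [bracket_add hs.smooth.differentiableAt_top heq.smooth.differentiableAt_top, hQS, h0,
      add_zero]
  · obtain ⟨hs, heq, hQEQ⟩ := key i z hz
    have he := VectorField.isHomogeneousAt_symbol hE hz
    have hq := VectorField.isHomogeneousAt_symbol hQ hz
    have hds := hs.smooth.differentiableAt_top
    have hde := he.smooth.differentiableAt_top
    have hdq := hq.smooth.differentiableAt_top
    have hdeq := heq.smooth.differentiableAt_top
    have hqq := odd_mul_self hq.mem
    have hQS : Cotangent.bracket (Q.symbol i) (S i) z = 0 := h.isQS.invariance i hz
    have hSS : Cotangent.bracket (S i) (S i) z = 0 := h.isQS.schouten i hz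
    have hES : Cotangent.bracket (E.symbol i) (S i) z = -S i z := h.homothety_S i hz
    have hEQ : Cotangent.bracket (E.symbol i) (Q.symbol i) z = -Q.symbol i z :=
      h.homothety_Q.bracket_symbol hE hQ hz
    have hSEQ : Cotangent.bracket (S i) (E.symbol i * Q.symbol i) z = S i z * Q.symbol i z := by
      -- {S,EQ} = {S,E}Q + E{S,Q}, with {S,E} = -{E,S} = S and {S,Q} = 0.
      rw [hs.bracket_mul hde hdq, hq.bracket_swap hs, he.bracket_swap hs, hQS, hES]
      simp
    have hEQEQ : Cotangent.bracket (E.symbol i * Q.symbol i) (E.symbol i * Q.symbol i) z = 0 := by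
      -- {EQ,EQ} = {EQ,E}Q + E{EQ,Q}. The second term vanishes by `hQEQ`; every term of {EQ,E} ends
      -- in Q, so the extra factor Q annihilates it, whatever {E,E} is.
      rw [heq.bracket_mul hde hdq, hq.bracket_swap heq, hQEQ, he.bracket_swap heq,
        he.bracket_mul hde hdq, hEQ]
      simp [add_mul, mul_assoc, hqq]
    -- The bracket is symmetric on odd functions. This supplies additivity in the first slot, as
    -- `bracket_add` concerns the second only.
    have hodd : ∀ {F G : SuperFn (Fin n ⊕ Fin n) (Fin m ⊕ Fin m)}, IsHomogeneousAt F 1 z →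
        IsHomogeneousAt G 1 z → Cotangent.bracket G F z = Cotangent.bracket F G z := by
      intro F G hF hG
      rw [hF.bracket_swap hG]
      simp [ZMod.val_one]
    have hsq : S i z * Q.symbol i z = -(Q.symbol i z * S i z) := by
      rw [mul_comm_sign hq.mem hs.mem]
      simp [ZMod.val_one]
    have hqeq : Q.symbol i z * (E.symbol i z * Q.symbol i z) = 0 := by
      rw [← mul_assoc, even_mul_comm he.mem, mul_assoc, hqq, mul_zero]
    change Cotangent.bracket (S i + E.symbol i * Q.symbol i) (S i + E.symbol i * Q.symbol i) z =
      (-2 : ℝ) • (Q.symbol i z * (S i z + E.symbol i z * Q.symbol i z))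
    rw [bracket_add hds hdeq, hodd hs (hs.add heq), hodd heq (hs.add heq), bracket_add hds hdeq,
      bracket_add hds hdeq, hSS, hodd hs heq, hSEQ, hEQEQ, mul_add, hqeq, hsq]
    module
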